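/- Let $\mathbb K$ be $\mathbb R$ or $\mathbb C$; all Banach spaces are over $\mathbb K$, and for $n\ge 1$, $\ell_p^n$ is $\mathbb K^n$ with the $\ell_p$-norm. An \emph{ideal norm} $\alpha$ on $\mathcal L(\ell_2^n,\cdot)$ assigns to every Banach space $X$ a norm $\alpha$ on $\mathcal L(\ell_2^n,X)$ such that $$\|TuA\|\le\alpha(TuA)\le\|T\|\,\alpha(u)\,\|A\|\quad\text{and}\quad \alpha(a\otimes x)=\|a\|\,\|x\|$$ for all Banach spaces $X,Y$ and all $T\in\mathcal L(X,Y)$, $u\in\mathcal L(\ell_2^n,X)$, $A\in\mathcal L(\ell_2^n,\ell_2^n)$, $a\in\ell_2^n$, $x\in X$. Similarly, an ideal norm $\beta$ on $\mathcal L(\cdot,\ell_2^n)$ assigns to every Banach space $Y$ a norm $\beta$ on $\mathcal L(Y,\ell_2^n)$ such that $$\|AvT\|\le\beta(AvT)\le\|A\|\,\beta(v)\,\|T\|\quad\text{and}\quad \beta(b\otimes y)=\|b\|_{Y^*}\|y\|$$ for all Banach spaces $X,Y$ and all $A\in\mathcal L(\ell_2^n,\ell_2^n)$, $v\in\mathcal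 L(Y,\ell_2^n)$, $T\in\mathcal L(X,Y)$, $b\in Y^*$, $y\in\ell_2^n$. An operator $T\in\mathcal L(X,Y)$ is absolutely $2$-summing if there is a constant $C>0$ with $$\Big(\sum_k\|Tx_k\|^2\Big)^{1/2}\le C\sup_{a\in B_{X^*}}\Big(\sum_k|\langle x_k,a\rangle|^2\Big)^{1/2}$$ for all finite sequences $(x_k)\subset X$; the infimum of such $C$ is denoted $\pi_2(T)$. Let $v^*$ denote the Banach space adjoint of $v$. There is an absolute constant $c>0$ such that for both scalar fields, every $n\ge1$, all ideal norms $\alpha$ on $\mathcal L(\ell_2^n,\cdot)$ and $\beta$ on $\mathcal L(\cdot,\ell_2^n)$, and every Banach space $X$: (1) for every $u\in\mathcal L(\ell_2^n,X)$, $$\sup\Big\{\frac{\alpha(w)}{\sqrt n} : \|w:\ell_2^n\to\ell_\infty^n\|=1\Big\}^3\,\pi_2(u)\le c\,\alpha(u);$$ (2) for every $v\in\mathcal L(X,\ell_2^n)$, $$\sup\Big\{\frac{\beta(w)}{\sqrt n} : \|w:\ell_1^n\to\ell_2^n\|=1\Big\}^3\,\pi_2(v^*)\le c\,\beta(v).$$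 Here the suprema are over non-empty bounded sets, and $u$ and $v^*$ are absolutely $2$-summing. -/

import Mathlib

universe v

/-- The space `ℓ_p^n` over `𝕜`, realised as the scalar functions on an index set `ι` with
`n` elements (`ι = Fin n` is the literal case) with the `ℓ_p` norm. -/
abbrev EllP (𝕜 : Type) (p : ENNReal) (ι : Type v) : Type v :=
  PiLp p (fun _ : ι => 𝕜)

/-- An ideal norm on `L(ℓ_2^n, ·)`: for every Banach space `X` a norm on the space of operators
`ℓ_2^n → X`, such that `‖T u A‖ ≤ α (T u A) ≤ ‖T‖ α(u) ‖A‖` and `α (a ⊗ x) = ‖a‖ ‖x‖`.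
(Definiteness of the norm is part of `‖T u A‖ ≤ α (T u A)`.) -/
structure IdealNormFrom (𝕜 : Type) [RCLike 𝕜] (ι : Type v) [Fintype ι] where
  /-- the norm on `L(ℓ_2^n, X)`, for each Banach space `X` -/
  nrm : ∀ (X : Type v) [NormedAddCommGroup X] [NormedSpace 𝕜 X] [CompleteSpace X],
    Seminorm 𝕜 (EllP 𝕜 2 ι →L[𝕜] X)
  opNorm_le : ∀ (X Y : Type v) [NormedAddCommGroup X] [NormedSpace 𝕜 X] [CompleteSpace X]
    [NormedAddCommGroup Y] [NormedSpace 𝕜 Y] [CompleteSpace Y]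
    (T : X →L[𝕜] Y) (u : EllP 𝕜 2 ι →L[𝕜] X) (A : EllP 𝕜 2 ι →L[𝕜] EllP 𝕜 2 ι),
    ‖T ∘L u ∘L A‖ ≤ nrm Y (T ∘L u ∘L A)
  ideal : ∀ (X Y : Type v) [NormedAddCommGroup X] [NormedSpace 𝕜 X] [CompleteSpace X]
    [NormedAddCommGroup Y] [NormedSpace 𝕜 Y] [CompleteSpace Y]
    (T : X →L[𝕜] Y) (u : EllP 𝕜 2 ι →L[𝕜] X) (A : EllP 𝕜 2 ι →L[𝕜] EllP 𝕜 2 ι),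
    nrm Y (T ∘L u ∘L A) ≤ ‖T‖ * nrm X u * ‖A‖
  rankOne : ∀ (X : Type v) [NormedAddCommGroup X] [NormedSpace 𝕜 X] [CompleteSpace X]
    (a : EllP 𝕜 2 ι) (x : X), nrm X ((innerSL 𝕜 a).smulRight x) = ‖a‖ * ‖x‖

/-- An ideal norm on `L(·, ℓ_2^n)`: for every Banach space `Y` a norm on the space of operators
`Y → ℓ_2^n`, such that `‖A v T‖ ≤ β (A v T) ≤ ‖A‖ β(v) ‖T‖` and `β (b ⊗ y) = ‖b‖ ‖y‖`.
(Definiteness of the norm is part of `‖A v T‖ ≤ β (A v T)`.) -/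
structure IdealNormTo (𝕜 : Type) [RCLike 𝕜] (ι : Type v) [Fintype ι] where
  /-- the norm on `L(Y, ℓ_2^n)`, for each Banach space `Y` -/
  nrm : ∀ (Y : Type v) [NormedAddCommGroup Y] [NormedSpace 𝕜 Y] [CompleteSpace Y],
    Seminorm 𝕜 (Y →L[𝕜] EllP 𝕜 2 ι)
  opNorm_le : ∀ (X Y : Type v) [NormedAddCommGroup X] [NormedSpace 𝕜 X] [CompleteSpace X]
    [NormedAddCommGroup Y] [NormedSpace 𝕜 Y] [CompleteSpace Y]
    (A : EllP 𝕜 2 ι →L[𝕜] EllP 𝕜 2 ι) (v : Y →L[𝕜] EllP 𝕜 2 ι) (T : X →L[𝕜] Y),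
    ‖A ∘L v ∘L T‖ ≤ nrm X (A ∘L v ∘L T)
  ideal : ∀ (X Y : Type v) [NormedAddCommGroup X] [NormedSpace 𝕜 X] [CompleteSpace X]
    [NormedAddCommGroup Y] [NormedSpace 𝕜 Y] [CompleteSpace Y]
    (A : EllP 𝕜 2 ι →L[𝕜] EllP 𝕜 2 ι) (v : Y →L[𝕜] EllP 𝕜 2 ι) (T : X →L[𝕜] Y),
    nrm X (A ∘L v ∘L T) ≤ ‖A‖ * nrm Y v * ‖T‖
  rankOne : ∀ (Y : Type v) [NormedAddCommGroup Y] [NormedSpace 𝕜 Y] [CompleteSpace Y]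
    (b : StrongDual 𝕜 Y) (y : EllP 𝕜 2 ι), nrm Y (b.smulRight y) = ‖b‖ * ‖y‖

/-- `C` is an absolutely 2-summing constant of `T`: for all finite sequences `(x_k)` in `X`,
`(∑ ‖T x_k‖²)^{1/2} ≤ C sup {(∑ |⟨x_k, a⟩|²)^{1/2} : a ∈ B_{X*}}`. -/
def IsTwoSummingConst {𝕜 : Type} [RCLike 𝕜] {X Y : Type v}
    [NormedAddCommGroup X] [NormedSpace 𝕜 X] [NormedAddCommGroup Y] [NormedSpace 𝕜 Y]
    (T : X →L[𝕜] Y) (C : ℝ) : Prop :=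
  ∀ (m : ℕ) (x : Fin m → X),
    √(∑ k, ‖T (x k)‖ ^ 2) ≤
      C * ⨆ a : Metric.closedBall (0 : StrongDual 𝕜 X) 1, √(∑ k, ‖a.1 (x k)‖ ^ 2)

/-- `T` is absolutely 2-summing. -/
def IsTwoSumming {𝕜 : Type} [RCLike 𝕜] {X Y : Type v}
    [NormedAddCommGroup X] [NormedSpace 𝕜 X] [NormedAddCommGroup Y] [NormedSpace 𝕜 Y]
    (T : X →L[𝕜] Y) : Prop :=
  ∃ C : ℝ, 0 < C ∧ IsTwoSummingConst T C

/-- The absolutely 2-summing norm `π₂(T)`, the best 2-summing constant of `T`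
(meaningful when `IsTwoSumming T`). -/
noncomputable def piTwo {𝕜 : Type} [RCLike 𝕜] {X Y : Type v}
    [NormedAddCommGroup X] [NormedSpace 𝕜 X] [NormedAddCommGroup Y] [NormedSpace 𝕜 Y]
    (T : X →L[𝕜] Y) : ℝ :=
  sInf {C : ℝ | 0 < C ∧ IsTwoSummingConst T C}

/-- The Banach space adjoint `T* : Y* → X*`, `b ↦ b ∘ T`. -/
noncomputable def dualOp {𝕜 : Type} [RCLike 𝕜] {X Y : Type v}
    [NormedAddCommGroup X] [NormedSpace 𝕜 X] [NormedAddCommGroup Y] [NormedSpace 𝕜 Y]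
    (T : X →L[𝕜] Y) : StrongDual 𝕜 Y →L[𝕜] StrongDual 𝕜 X :=
  T.precomp 𝕜

/-- The numbers `α(w)/√n` with `‖w : ℓ_2^n → ℓ_∞^n‖ = 1`. -/
def IdealNormFrom.ratios {𝕜 : Type} [RCLike 𝕜] {ι : Type v} [Fintype ι]
    (α : IdealNormFrom 𝕜 ι) : Set ℝ :=
  {t | ∃ w : EllP 𝕜 2 ι →L[𝕜] EllP 𝕜 ⊤ ι,
    ‖w‖ = 1 ∧ t = α.nrm (EllP 𝕜 ⊤ ι) w / √(Fintype.card ι : ℝ)}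

/-- The numbers `β(w)/√n` with `‖w : ℓ_1^n → ℓ_2^n‖ = 1`. -/
def IdealNormTo.ratios {𝕜 : Type} [RCLike 𝕜] {ι : Type v} [Fintype ι]
    (β : IdealNormTo 𝕜 ι) : Set ℝ :=
  {t | ∃ w : EllP 𝕜 1 ι →L[𝕜] EllP 𝕜 2 ι,
    ‖w‖ = 1 ∧ t = β.nrm (EllP 𝕜 1 ι) w / √(Fintype.card ι : ℝ)}

/-!
The proof gives the stronger bound `δ² π₂(u) ≤ c α(u)` for the supremum `δ` of the ratios; since
`δ` is bounded by an absolute constant, the bound with `δ³` follows.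

Let `‖w : ℓ_2^n → ℓ_∞^n‖ = 1`. A functional that norms `α` at `w` has the form
`x ↦ ∑ j, (x (h j)) j` with vectors `h j ∈ ℓ_2^n`
(`IdealNormFrom.exists_norming`). The rank one axiom makes `t ↦ ∑ t j • h j` a contraction from
`ℓ_∞^n` to `ℓ_2^n`, and `α(w) ≤ ∑ ‖h j‖`. The little Grothendieck inequality
(`isSumConst_of_norm_le`) and Pietsch domination (`IsSumConst.exists_weights`) provide weights `p`
with sum one such that the vectors `g j = h j / (7 √(p j))` are the images of the unit vectors under
a contraction of `ℓ_2^n`; such families are called Bessel here. By the Cauchy-Schwarz inequality the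
numbers `q j = ⟪g j, h j⟫ ≥ 0` have sum at least `(∑ ‖h j‖)² / (7 √n)`, that is, of the order
`√n (α(w) / √n)²`, and the same weights give `∑ ‖h j‖ ≤ 7 √n`, hence `α(w) ≤ 7 √n`
(`exists_isBessel_inner`).

Now let `z` be another Bessel family. Testing the functional on `T u B`, where the coordinates of
`T : X → ℓ_∞^n` are signed norming functionals of the `u (z j)` and `B = ∑ ± g i ⊗ z i`, and
averaging over the signs shows `∑ q j ‖u (z j)‖ ≤ α(u)` (`IdealNormFrom.sum_mul_norm_le`).

It remains to choose `z` so that this sum is large. Up to a factor `√2`, `π₂(u)` is attained on an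
orthonormal system of `n` vectors (`exists_orthonormal_sum_le`): at a family maximising
`∑ ‖u (x k)‖²` among Bessel families, first order optimality shows that one can split off a unit
vector `z` at the cost of `2 ‖u z‖²`, and induction on the dimension applies. Repeating the members of
that system in blocks of suitable lengths (`exists_assignment`) turns the `ℓ_2` sum of the norms into
an `ℓ_1` sum, and a permutation (`exists_perm_sum_mul_sum_le`) decouples it from the `q j`. The
result is `exists_isBessel_sum_le`.

For `β` the same argument is applied to `u = v* ∘ J`, where `J` is the bilinear identification of
`ℓ_2^n` with its dual (`euclideanDual`).
-/

open Finset

/-! ### Rademacher sums -/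

/-- The Rademacher sign at `i` of the sign pattern that is `+1` exactly on `A`. -/
def sgn (𝕜 : Type*) [RCLike 𝕜] {I : Type*} [DecidableEq I] (A : Finset I) (i : I) : 𝕜 :=
  if i ∈ A then 1 else -1

lemma norm_sub_pow_four_add_norm_add_pow_four_le (𝕜 : Type*) [RCLike 𝕜] {H : Type*}
    [NormedAddCommGroup H] [InnerProductSpace 𝕜 H] (S y : H) :
    ‖S - y‖ ^ 4 + ‖S + y‖ ^ 4 ≤ 2 * ‖S‖ ^ 4 + 12 * (‖S‖ ^ 2 * ‖y‖ ^ 2) + 2 * ‖y‖ ^ 4 := by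
  have h1 := parallelogram_law_with_norm 𝕜 S y
  have h2 : ‖S + y‖ ^ 2 - ‖S - y‖ ^ 2 = 4 * RCLike.re (inner 𝕜 S y) := by
    rw [norm_add_sq (𝕜 := 𝕜), norm_sub_sq (𝕜 := 𝕜)]; ring
  have h3 : |RCLike.re (inner 𝕜 S y)| ≤ ‖S‖ * ‖y‖ :=
    (RCLike.abs_re_le_norm _).trans (norm_inner_le_norm S y)
  have h4 := sq_le_sq' (abs_le.1 h3).1 (abs_le.1 h3).2
  have h5 : ‖S - y‖ ^ 4 + ‖S + y‖ ^ 4 =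
      ((‖S + y‖ ^ 2 + ‖S - y‖ ^ 2) ^ 2 + (‖S + y‖ ^ 2 - ‖S - y‖ ^ 2) ^ 2) / 2 := by ring
  have h6 : ‖S + y‖ ^ 2 + ‖S - y‖ ^ 2 = 2 * (‖S‖ ^ 2 + ‖y‖ ^ 2) := by linarith
  rw [h5, h2, h6]
  nlinarith

section Signs

variable {𝕜 : Type*} [RCLike 𝕜] {I : Type*} [DecidableEq I]

lemma norm_sgn (A : Finset I) (i : I) : ‖sgn 𝕜 A i‖ = 1 := by
  unfold sgn; split_ifs <;> simp

lemma sgn_insert_of_ne {A : Finset I} {a i : I} (h : i ≠ a) :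
    sgn 𝕜 (insert a A) i = sgn 𝕜 A i := by
  simp [sgn, h]

variable {H : Type*} [NormedAddCommGroup H] [InnerProductSpace 𝕜 H]

lemma sum_sgn_insert_insert {s A : Finset I} {a : I} (ha : a ∉ s) (y : I → H) :
    ∑ i ∈ insert a s, sgn 𝕜 (insert a A) i • y i = ∑ i ∈ s, sgn 𝕜 A i • y i + y a := by
  rw [sum_insert ha, add_comm]
  congr 1
  · exact sum_congr rfl fun i hi => by rw [sgn_insert_of_ne (ne_of_mem_of_not_mem hi ha)]
  · simp [sgn]

lemma sum_sgn_insert {s A : Finset I} {a : I} (ha : a ∉ s) (hA : A ⊆ s) (y : I → H) :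
    ∑ i ∈ insert a s, sgn 𝕜 A i • y i = ∑ i ∈ s, sgn 𝕜 A i • y i - y a := by
  have : a ∉ A := fun h => ha (hA h)
  rw [sum_insert ha, add_comm, sub_eq_add_neg]
  simp [sgn, this]

lemma sum_powerset_norm_sq (y : I → H) (s : Finset I) :
    ∑ A ∈ s.powerset, ‖∑ i ∈ s, sgn 𝕜 A i • y i‖ ^ 2 = 2 ^ #s * ∑ i ∈ s, ‖y i‖ ^ 2 := by
  induction s using Finset.induction_on with
  | empty => simp
  | insert a s ha ih =>
    rw [sum_powerset_insert ha, ← sum_add_distrib]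
    have : ∀ A ∈ s.powerset, ‖∑ i ∈ insert a s, sgn 𝕜 A i • y i‖ ^ 2 +
        ‖∑ i ∈ insert a s, sgn 𝕜 (insert a A) i • y i‖ ^ 2 =
        2 * ‖∑ i ∈ s, sgn 𝕜 A i • y i‖ ^ 2 + 2 * ‖y a‖ ^ 2 := by
      intro A hA
      rw [sum_sgn_insert ha (mem_powerset.1 hA), sum_sgn_insert_insert ha]
      have := parallelogram_law_with_norm 𝕜 (∑ i ∈ s, sgn 𝕜 A i • y i) (y a)
      linarith
    rw [sum_congr rfl this, sum_add_distrib, ← mul_sum, ih, sum_insert ha, card_insert_of_notMem ha]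
    simp
    ring

/-- The fourth-moment Khintchine inequality for Rademacher sums. -/
lemma sum_powerset_norm_pow_four_le (y : I → H) (s : Finset I) :
    ∑ A ∈ s.powerset, ‖∑ i ∈ s, sgn 𝕜 A i • y i‖ ^ 4 ≤
      3 * 2 ^ #s * (∑ i ∈ s, ‖y i‖ ^ 2) ^ 2 := by
  induction s using Finset.induction_on with
  | empty => simp
  | insert a s ha ih =>
    rw [sum_powerset_insert ha, ← sum_add_distrib]
    have : ∀ A ∈ s.powerset, ‖∑ i ∈ insert a s, sgn 𝕜 A i • y i‖ ^ 4 +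
        ‖∑ i ∈ insert a s, sgn 𝕜 (insert a A) i • y i‖ ^ 4 ≤
        2 * ‖∑ i ∈ s, sgn 𝕜 A i • y i‖ ^ 4 +
          12 * (‖∑ i ∈ s, sgn 𝕜 A i • y i‖ ^ 2 * ‖y a‖ ^ 2) + 2 * ‖y a‖ ^ 4 := by
      intro A hA
      rw [sum_sgn_insert ha (mem_powerset.1 hA), sum_sgn_insert_insert ha]
      exact norm_sub_pow_four_add_norm_add_pow_four_le 𝕜 _ _
    refine (sum_le_sum this).trans ?_
    rw [sum_add_distrib, sum_add_distrib, ← mul_sum, ← mul_sum, ← sum_mul,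
      sum_powerset_norm_sq, sum_insert ha, card_insert_of_notMem ha, sum_const, card_powerset,
      nsmul_eq_mul]
    push_cast
    have h2 : (0 : ℝ) < 2 ^ #s := by positivity
    have h3 : (0 : ℝ) ≤ 2 ^ #s * ‖y a‖ ^ 4 := by positivity
    rw [pow_succ (2 : ℝ)]
    nlinarith

/-- Averaging a quadratic form over all sign patterns leaves only its diagonal. -/
lemma sum_powerset_sgn_mul_sgn_mul (m : I → I → 𝕜) (s : Finset I) :
    ∑ A ∈ s.powerset, ∑ i ∈ s, ∑ j ∈ s, sgn 𝕜 A i * sgn 𝕜 A j * m i j =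
      2 ^ #s * ∑ i ∈ s, m i i := by
  induction s using Finset.induction_on with
  | empty => simp
  | insert a s ha ih =>
    rw [sum_powerset_insert ha, ← sum_add_distrib]
    have key : ∀ A ∈ s.powerset,
        ∑ i ∈ insert a s, ∑ j ∈ insert a s, sgn 𝕜 A i * sgn 𝕜 A j * m i j +
          ∑ i ∈ insert a s, ∑ j ∈ insert a s,
            sgn 𝕜 (insert a A) i * sgn 𝕜 (insert a A) j * m i j =
        2 * (∑ i ∈ s, ∑ j ∈ s, sgn 𝕜 A i * sgn 𝕜 A j * m i j) + 2 * m a a := by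
      intro A hA
      have haA : a ∉ A := fun h => ha (mem_powerset.1 hA h)
      have e1 : sgn 𝕜 A a = -1 := by simp [sgn, haA]
      have e2 : sgn 𝕜 (insert a A) a = 1 := by simp [sgn]
      have e3 : ∀ i ∈ s, sgn 𝕜 (insert a A) i = sgn 𝕜 A i := fun i hi =>
        sgn_insert_of_ne (ne_of_mem_of_not_mem hi ha)
      have e4 : ∑ i ∈ s, sgn 𝕜 (insert a A) i * m i a = ∑ i ∈ s, sgn 𝕜 A i * m i a :=
        sum_congr rfl fun i hi => by rw [e3 i hi]
      have e5 : ∑ i ∈ s, sgn 𝕜 (insert a A) i * m a i = ∑ i ∈ s, sgn 𝕜 A i * m a i :=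
        sum_congr rfl fun i hi => by rw [e3 i hi]
      have e6 : ∑ i ∈ s, ∑ j ∈ s, sgn 𝕜 (insert a A) i * sgn 𝕜 (insert a A) j * m i j =
          ∑ i ∈ s, ∑ j ∈ s, sgn 𝕜 A i * sgn 𝕜 A j * m i j :=
        sum_congr rfl fun i hi => sum_congr rfl fun j hj => by rw [e3 i hi, e3 j hj]
      simp only [sum_insert ha, e1, e2, sum_add_distrib, e6, mul_one, one_mul, e4, e5]
      simp only [mul_neg, neg_mul, sum_neg_distrib, one_mul, mul_one, neg_neg]
      ring
    rw [sum_congr rfl key, sum_add_distrib, ← mul_sum, ih, sum_insert ha, card_insert_of_notMem ha]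
    simp
    ring

lemma norm_sum_diag_le [Fintype I] {m : I → I → 𝕜} {C : ℝ}
    (h : ∀ A : Finset I, ‖∑ i, ∑ j, sgn 𝕜 A i * sgn 𝕜 A j * m i j‖ ≤ C) :
    ‖∑ i, m i i‖ ≤ C := by
  have h1 := congrArg norm (sum_powerset_sgn_mul_sgn_mul m (univ : Finset I))
  have h2 : ‖∑ A ∈ (univ : Finset I).powerset, ∑ i, ∑ j, sgn 𝕜 A i * sgn 𝕜 A j * m i j‖ ≤
      2 ^ #(univ : Finset I) * C := by
    refine (norm_sum_le_of_le _ fun A _ => h A).trans ?_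
    simp
  rw [h1] at h2
  simp only [norm_mul, norm_pow, RCLike.norm_ofNat] at h2
  exact le_of_mul_le_mul_left h2 (by positivity)

end Signs

/-! ### The little Grothendieck inequality and Pietsch domination -/

section LittleGrothendieck

variable {𝕜 : Type*} [RCLike 𝕜] {ι : Type*} [Fintype ι]
  {H : Type*} [NormedAddCommGroup H] [InnerProductSpace 𝕜 H]

variable (𝕜) in
/-- The 2-summing inequality with squared constant `C`, for the operator `ℓ_∞ → H` that sends the
`j`-th unit vector to `h j`. -/
def IsSumConst (h : ι → H) (C : ℝ) : Prop :=
  ∀ (I : Type) [Fintype I] (s : I → ι → 𝕜) (B : ℝ), 0 < B →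
    (∀ j, ∑ i, ‖s i j‖ ^ 2 ≤ B) → ∑ i, ‖∑ j, s i j • h j‖ ^ 2 ≤ C * B

lemma isSumConst_crude (h : ι → H) :
    IsSumConst 𝕜 h (Fintype.card ι * ∑ j, ‖h j‖ ^ 2) := by
  intro I _ s B hB hs
  have h1 : ∀ i, ‖∑ j, s i j • h j‖ ^ 2 ≤
      Fintype.card ι * ∑ j, ‖s i j‖ ^ 2 * ‖h j‖ ^ 2 := by
    intro i
    have := sq_sum_le_card_mul_sum_sq (s := (univ : Finset ι)) (f := fun j => ‖s i j • h j‖)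
    simp only [norm_smul, mul_pow] at this
    refine le_trans ?_ this
    gcongr
    exact (norm_sum_le _ _).trans_eq (by simp only [norm_smul])
  refine (sum_le_sum fun i _ => h1 i).trans ?_
  rw [← mul_sum, sum_comm, mul_assoc]
  gcongr
  rw [sum_mul]
  refine sum_le_sum fun j _ => ?_
  rw [← sum_mul, mul_comm]
  gcongr
  exact hs j

/-- Truncating the Rademacher sums `∑ i, ± s i j` at height `√(12 B)` halves the excess of a
2-summing constant: the bounded part is controlled by the norm of `ℓ_∞ → H`, the tail by the
given constant, since the fourth-moment inequality bounds its second moment by `B / 4`. -/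
lemma IsSumConst.improve {h : ι → H} {C : ℝ}
    (hh : ∀ (t : ι → 𝕜) (M : ℝ), 0 ≤ M → (∀ j, ‖t j‖ ≤ M) → ‖∑ j, t j • h j‖ ≤ M)
    (hC : IsSumConst 𝕜 h C) : IsSumConst 𝕜 h (24 + C / 2) := by
  classical
  intro I _ s B hB hs
  set N : ℝ := 2 ^ #(univ : Finset I) with hN
  have hNpos : 0 < N := by positivity
  let S : Finset I → ι → 𝕜 := fun A j => ∑ i, sgn 𝕜 A i • s i j
  -- The Rademacher sums `S` are split into a bounded part `L` and a tail `U`.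
  let L : Finset I → ι → 𝕜 := fun A j => if ‖S A j‖ ^ 2 ≤ 12 * B then S A j else 0
  let U : Finset I → ι → 𝕜 := fun A j => if ‖S A j‖ ^ 2 ≤ 12 * B then 0 else S A j
  have hLU : ∀ A j, S A j = L A j + U A j := by
    intro A j
    simp only [L, U]
    split_ifs <;> simp
  have hL : ∀ A, ‖∑ j, L A j • h j‖ ^ 2 ≤ 12 * B := by
    intro A
    have := hh (L A) (√(12 * B)) (by positivity) fun j => by
      simp only [L]
      split_ifs with hj
      · exact Real.le_sqrt_of_sq_le hj
      · simp
    calc _ ≤ √(12 * B) ^ 2 := by gcongr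
      _ = 12 * B := Real.sq_sqrt (by positivity)
  have hU : ∑ A : Finset I, ‖∑ j, U A j • h j‖ ^ 2 ≤ C * (N * B / 4) := by
    refine hC (Finset I) U (N * B / 4) (by positivity) fun j => ?_
    have h4 := sum_powerset_norm_pow_four_le (𝕜 := 𝕜) (fun i => s i j) (univ : Finset I)
    rw [powerset_univ] at h4
    have h5 : ∀ A : Finset I, 12 * B * ‖U A j‖ ^ 2 ≤ ‖∑ i, sgn 𝕜 A i • s i j‖ ^ 4 := by
      intro A
      simp only [U]
      split_ifs with hj
      · simp
      · have : ‖S A j‖ ^ 4 = ‖S A j‖ ^ 2 * ‖S A j‖ ^ 2 := by ring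
        change _ ≤ ‖S A j‖ ^ 4
        rw [this]
        gcongr
        exact (not_le.1 hj).le
    have h6 := sum_le_sum fun A (_ : A ∈ (univ : Finset (Finset I))) => h5 A
    rw [← mul_sum] at h6
    have h7 : (∑ i, ‖s i j‖ ^ 2) ^ 2 ≤ B ^ 2 := by
      gcongr
      exact hs j
    have h8 : 12 * B * ∑ A : Finset I, ‖U A j‖ ^ 2 ≤ 12 * B * (N * B / 4) := by
      calc _ ≤ 3 * N * B ^ 2 := h6.trans (h4.trans (by gcongr))
        _ = _ := by ring
    exact le_of_mul_le_mul_left h8 (by positivity)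
  have h2 := sum_powerset_norm_sq (𝕜 := 𝕜) (fun i => ∑ j, s i j • h j) (univ : Finset I)
  rw [powerset_univ] at h2
  have hS : ∀ A : Finset I, ‖∑ i, sgn 𝕜 A i • ∑ j, s i j • h j‖ ^ 2 ≤
      2 * (12 * B) + 2 * ‖∑ j, U A j • h j‖ ^ 2 := by
    intro A
    have e : ∑ i, sgn 𝕜 A i • ∑ j, s i j • h j = ∑ j, L A j • h j + ∑ j, U A j • h j := by
      rw [← sum_add_distrib]
      simp only [← add_smul, ← hLU]
      simp only [S, smul_sum, sum_smul, smul_assoc]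
      exact sum_comm
    rw [e]
    have h3 := norm_add_le (∑ j, L A j • h j) (∑ j, U A j • h j)
    have h4 := pow_le_pow_left₀ (norm_nonneg _) h3 2
    nlinarith [hL A, sq_nonneg (‖∑ j, L A j • h j‖ - ‖∑ j, U A j • h j‖)]
  have h9 := sum_le_sum fun A (_ : A ∈ (univ : Finset (Finset I))) => hS A
  have hN' : (#(univ : Finset (Finset I)) : ℝ) = N := by simp [hN]
  rw [h2, sum_add_distrib, sum_const, ← mul_sum, nsmul_eq_mul, hN', ← hN] at h9
  have : N * ∑ i, ‖∑ j, s i j • h j‖ ^ 2 ≤ N * ((24 + C / 2) * B) := by nlinarith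
  exact le_of_mul_le_mul_left this hNpos

/-- The **little Grothendieck inequality**: an operator of norm at most one from `ℓ_∞` to a
Hilbert space is 2-summing with an absolute constant. -/
theorem isSumConst_of_norm_le {h : ι → H}
    (hh : ∀ (t : ι → 𝕜) (M : ℝ), 0 ≤ M → (∀ j, ‖t j‖ ≤ M) → ‖∑ j, t j • h j‖ ≤ M) :
    IsSumConst 𝕜 h 48 := by
  set D : ℝ := Fintype.card ι * ∑ j, ‖h j‖ ^ 2
  have hk : ∀ k : ℕ, IsSumConst 𝕜 h (48 + D * (1 / 2) ^ k) := by
    intro k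
    induction k with
    | zero =>
      intro I _ s B hB hs
      have := isSumConst_crude h I s B hB hs
      simp only [pow_zero, mul_one]
      nlinarith
    | succ k ih =>
      have := ih.improve hh
      convert this using 1
      ring
  intro I _ s B hB hs
  refine ge_of_tendsto' (x := Filter.atTop)
    (f := fun k : ℕ => (48 + D * (1 / 2 : ℝ) ^ k) * B) ?_ fun k => hk k I s B hB hs
  have h0 := tendsto_pow_atTop_nhds_zero_of_lt_one (r := (1 / 2 : ℝ)) (by norm_num) (by norm_num)
  simpa using ((h0.const_mul D).const_add 48).mul_const B

/-- Pietsch domination for a 2-summing operator `ℓ_∞ → H`: the dominating measure is given by the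
weights `p`. -/
theorem IsSumConst.exists_weights [Nonempty ι] {h : ι → H} {C : ℝ} (hC0 : 0 < C)
    (hC : IsSumConst 𝕜 h C) :
    ∃ p : ι → ℝ, (∀ j, 0 ≤ p j) ∧ ∑ j, p j = 1 ∧
      ∀ s : ι → 𝕜, ‖∑ j, s j • h j‖ ^ 2 ≤ C * ∑ j, p j * ‖s j‖ ^ 2 := by
  classical
  -- The 2-summing inequality says that convex combinations of the values of `Ψ` do not lie in the
  -- open negative orthant `O`; the weights are the coefficients of a separating functional.
  let Ψ : (ι → 𝕜) → ι → ℝ := fun s j => C * ‖s j‖ ^ 2 - ‖∑ j, s j • h j‖ ^ 2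
  let O : Set (ι → ℝ) := {x | ∀ j, x j < 0}
  have hOo : IsOpen O := by
    have : O = Set.univ.pi fun _ => Set.Iio 0 := by ext; simp [O]
    rw [this]
    exact isOpen_set_pi Set.finite_univ fun _ _ => isOpen_Iio
  have hOc : Convex ℝ O := by
    have : O = Set.univ.pi fun _ => Set.Iio 0 := by ext; simp [O]
    rw [this]
    exact convex_pi fun _ _ => convex_Iio 0
  have hdisj : Disjoint O (convexHull ℝ (Set.range Ψ)) := by
    rw [Set.disjoint_left]
    intro x hxO hx
    obtain ⟨I, _, w, z, hw0, hw1, hz, rfl⟩ := mem_convexHull_iff_exists_fintype.1 hx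
    choose s hs using hz
    have hneg : ∀ j, C * ∑ i, w i * ‖s i j‖ ^ 2 < ∑ i, w i * ‖∑ j, s i j • h j‖ ^ 2 := by
      intro j
      have := hxO j
      simp only [Finset.sum_apply, Pi.smul_apply, smul_eq_mul, ← hs, Ψ, mul_sub,
        sum_sub_distrib] at this
      rw [mul_sum]
      have e : ∑ i, C * (w i * ‖s i j‖ ^ 2) = ∑ i, w i * (C * ‖s i j‖ ^ 2) :=
        sum_congr rfl fun i _ => by ring
      linarith
    obtain ⟨j₀, hj₀⟩ := Finite.exists_max fun j => ∑ i, w i * ‖s i j‖ ^ 2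
    set E := ∑ i, w i * ‖∑ j, s i j • h j‖ ^ 2 with hE
    set B₀ := ∑ i, w i * ‖s i j₀‖ ^ 2 with hB₀
    have hB₀0 : 0 ≤ B₀ := sum_nonneg fun i _ => by have := hw0 i; positivity
    have hlt := hneg j₀
    have hB : B₀ < E / C := by rw [lt_div_iff₀ hC0]; linarith
    obtain ⟨B, hB1, hB2⟩ := exists_between hB
    have hn : ∀ i, ‖((√(w i) : ℝ) : 𝕜)‖ ^ 2 = w i := fun i => by
      rw [RCLike.norm_ofReal, sq_abs, Real.sq_sqrt (hw0 i)]
    have key := hC I (fun i j => ((√(w i) : ℝ) : 𝕜) * s i j) B (hB₀0.trans_lt hB1) fun j => by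
      simp only [norm_mul, mul_pow, hn]
      exact (hj₀ j).trans hB1.le
    have e2 : ∑ i, ‖∑ j, (((√(w i) : ℝ) : 𝕜) * s i j) • h j‖ ^ 2 = E := by
      refine sum_congr rfl fun i _ => ?_
      simp only [mul_smul, ← smul_sum, norm_smul, mul_pow, hn]
    rw [e2] at key
    rw [lt_div_iff₀ hC0] at hB2
    linarith
  obtain ⟨f, u, hfO, hfΨ⟩ := geometric_hahn_banach_open hOc hOo (convex_convexHull ℝ _) hdisj
  have hu : ∀ s, u ≤ f (Ψ s) := fun s => hfΨ _ (subset_convexHull ℝ _ ⟨s, rfl⟩)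
  have hu0 : u ≤ 0 := by
    have := hu 0
    have e : Ψ 0 = 0 := by ext; simp [Ψ]
    simpa [e] using this
  -- Negative multiples of the all-ones vector tend to `0`, so the separating level is `0`.
  have hu1 : 0 ≤ u := by
    have h1 : ∀ k : ℕ, f (-((1 / ((k : ℝ) + 1)) • (1 : ι → ℝ))) ≤ u := fun k =>
      (hfO _ fun j => by simp; positivity).le
    refine le_of_tendsto' (x := Filter.atTop) ?_ h1
    have h0 := tendsto_one_div_add_atTop_nhds_zero_nat (𝕜 := ℝ)
    simpa using (h0.mul_const (f 1)).neg
  have hu' : u = 0 := le_antisymm hu0 hu1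
  subst hu'
  let p : ι → ℝ := fun j => f (Pi.single j 1)
  have hfp : ∀ x, f x = ∑ j, p j * x j := by
    intro x
    conv_lhs => rw [← Finset.univ_sum_single x]
    rw [map_sum]
    refine sum_congr rfl fun j _ => ?_
    have : (Pi.single j (x j) : ι → ℝ) = x j • Pi.single j 1 := by
      rw [← Pi.single_smul]; simp
    rw [this, map_smul, smul_eq_mul, mul_comm]
  have hp0 : ∀ j, 0 ≤ p j := by
    intro j
    by_contra! hj
    have hsum : 0 < 1 + |∑ i, p i| := by positivity
    have := hfO (-((-p j / (1 + |∑ i, p i|)) • (1 : ι → ℝ) + Pi.single j 1)) fun i => by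
      have h1 : (0 : ℝ) ≤ (Pi.single j 1 : ι → ℝ) i := by
        rw [Pi.single_apply]; split_ifs <;> norm_num
      have h2 : 0 < -p j / (1 + |∑ i, p i|) := div_pos (by linarith) hsum
      simp only [Pi.neg_apply, Pi.add_apply, Pi.smul_apply, Pi.one_apply, smul_eq_mul, mul_one]
      linarith
    rw [map_neg, map_add, map_smul, hfp 1] at this
    simp only [Pi.one_apply, mul_one, smul_eq_mul] at this
    change -(_ + p j) < 0 at this
    have h3 : -p j / (1 + |∑ i, p i|) * ∑ i, p i ≤ -p j := by
      rw [div_mul_eq_mul_div, div_le_iff₀ hsum]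
      nlinarith [le_abs_self (∑ i, p i)]
    linarith
  have hpos : 0 < ∑ j, p j := by
    have := hfO (-1) fun j => by simp
    rw [map_neg, hfp 1] at this
    simpa using this
  refine ⟨fun j => p j / ∑ i, p i, fun j => div_nonneg (hp0 j) hpos.le, ?_, fun s => ?_⟩
  · rw [← sum_div, div_self hpos.ne']
  · have := hu s
    rw [hfp] at this
    simp only [Ψ, mul_sub, sum_sub_distrib, ← sum_mul] at this
    have e : ∑ j, p j / (∑ i, p i) * ‖s j‖ ^ 2 = (∑ j, p j * ‖s j‖ ^ 2) / ∑ i, p i := by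
      rw [sum_div]
      exact sum_congr rfl fun j _ => by ring
    rw [e, mul_div_assoc', le_div_iff₀ hpos, mul_sum (f := fun j => p j * ‖s j‖ ^ 2)]
    have e2 : ∑ j, C * (p j * ‖s j‖ ^ 2) = ∑ j, p j * (C * ‖s j‖ ^ 2) :=
      sum_congr rfl fun j _ => by ring
    rw [e2]
    linarith

end LittleGrothendieck

/-! ### Bessel families and few vectors for the 2-summing norm -/

/-- The family `x` is the image of the unit vectors under an operator of norm at most one from
`ℓ_2` into `E`. -/
def IsBessel (𝕜 : Type*) [RCLike 𝕜] {κ E : Type*} [Fintype κ] [NormedAddCommGroup E]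
    [NormedSpace 𝕜 E] (x : κ → E) : Prop :=
  ∀ t : κ → 𝕜, ‖∑ k, t k • x k‖ ^ 2 ≤ ∑ k, ‖t k‖ ^ 2

namespace IsBessel

section NormedSpace

variable {𝕜 : Type*} [RCLike 𝕜] {κ E F : Type*} [Fintype κ]
  [NormedAddCommGroup E] [NormedSpace 𝕜 E] [NormedAddCommGroup F] [NormedSpace 𝕜 F] {x : κ → E}

lemma norm_le_one (hx : IsBessel 𝕜 x) (k : κ) : ‖x k‖ ≤ 1 := by
  classical
  have := hx (Pi.single k 1)
  simp only [Pi.single_apply, ite_smul, one_smul, zero_smul, sum_ite_eq', mem_univ, if_true,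
    apply_ite (fun a : 𝕜 => ‖a‖ ^ 2), norm_one, norm_zero] at this
  simp only [one_pow, ne_eq, OfNat.ofNat_ne_zero, not_false_eq_true, zero_pow, sum_ite_eq',
    mem_univ, if_true] at this
  exact (sq_le_one_iff₀ (norm_nonneg _)).1 this

lemma sum_norm_apply_sq_le (hx : IsBessel 𝕜 x) (a : StrongDual 𝕜 E) :
    ∑ k, ‖a (x k)‖ ^ 2 ≤ ‖a‖ ^ 2 := by
  set R := ∑ k, ‖a (x k)‖ ^ 2 with hR
  have hR0 : 0 ≤ R := by positivity
  have h1 := hx fun k => star (a (x k))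
  simp only [norm_star] at h1
  have h2 : a (∑ k, star (a (x k)) • x k) = ((R : ℝ) : 𝕜) := by
    rw [map_sum, hR]
    push_cast
    refine sum_congr rfl fun k _ => ?_
    rw [map_smul, smul_eq_mul, RCLike.star_def, RCLike.conj_mul]
  have h3 := a.le_opNorm (∑ k, star (a (x k)) • x k)
  rw [h2, RCLike.norm_ofReal, abs_of_nonneg hR0] at h3
  have h4 : R * R ≤ ‖a‖ ^ 2 * R := by
    calc R * R ≤ (‖a‖ * ‖∑ k, star (a (x k)) • x k‖) * (‖a‖ * ‖∑ k, star (a (x k)) • x k‖) := by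
          gcongr
      _ = ‖a‖ ^ 2 * ‖∑ k, star (a (x k)) • x k‖ ^ 2 := by ring
      _ ≤ ‖a‖ ^ 2 * R := by gcongr
  rcases hR0.eq_or_lt with h | h
  · rw [← h]; positivity
  · exact le_of_mul_le_mul_right h4 h

lemma map (hx : IsBessel 𝕜 x) {T : E →L[𝕜] F} (hT : ‖T‖ ≤ 1) : IsBessel 𝕜 fun k => T (x k) := by
  intro t
  have : ∑ k, t k • T (x k) = T (∑ k, t k • x k) := by simp
  rw [this]
  refine le_trans ?_ (hx t)
  gcongr
  exact (T.le_opNorm _).trans (mul_le_of_le_one_left (norm_nonneg _) hT)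

end NormedSpace

variable {𝕜 : Type*} [RCLike 𝕜] {κ H : Type*} [Fintype κ]
  [NormedAddCommGroup H] [InnerProductSpace 𝕜 H] {x : κ → H}

lemma sum_norm_inner_sq_le (hx : IsBessel 𝕜 x) (w : H) :
    ∑ k, ‖inner 𝕜 (x k) w‖ ^ 2 ≤ ‖w‖ ^ 2 := by
  have := hx.sum_norm_apply_sq_le (innerSL 𝕜 w)
  rw [innerSL_apply_norm] at this
  refine le_of_eq_of_le (sum_congr rfl fun k _ => ?_) this
  rw [innerSL_apply_apply, norm_inner_symm]

/-- If `Z` is the contraction with `Z e_k = x k`, then `Z Zᴴ Z` is a contraction. -/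
lemma sum_inner_smul (hx : IsBessel 𝕜 x) : IsBessel 𝕜 fun k => ∑ i, inner 𝕜 (x i) (x k) • x i := by
  intro t
  have : ∑ k, t k • ∑ i, inner 𝕜 (x i) (x k) • x i =
      ∑ i, inner 𝕜 (x i) (∑ k, t k • x k) • x i := by
    simp only [smul_sum, inner_sum, inner_smul_right, sum_smul, mul_smul]
    exact sum_comm
  rw [this]
  exact (hx _).trans ((hx.sum_norm_inner_sq_le _).trans (hx t))

lemma _root_.Orthonormal.isBessel (hx : Orthonormal 𝕜 x) : IsBessel 𝕜 x := by
  intro t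
  have h := hx.inner_sum t t univ
  refine le_of_eq (RCLike.ofReal_injective (K := 𝕜) ?_)
  rw [inner_self_eq_norm_sq_to_K] at h
  push_cast
  rw [h]
  exact sum_congr rfl fun k _ => RCLike.conj_mul _

end IsBessel

section Orthonormal

variable {𝕜 : Type*} [RCLike 𝕜]

lemma exists_isBessel_max {κ H X : Type*} [Fintype κ] [NormedAddCommGroup H] [InnerProductSpace 𝕜 H]
    [FiniteDimensional 𝕜 H] [NormedAddCommGroup X] [NormedSpace 𝕜 X] (u : H →L[𝕜] X) :
    ∃ x : κ → H, IsBessel 𝕜 x ∧ ∀ y : κ → H, IsBessel 𝕜 y →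
      ∑ k, ‖u (y k)‖ ^ 2 ≤ ∑ k, ‖u (x k)‖ ^ 2 := by
  have : ProperSpace H := FiniteDimensional.proper_rclike 𝕜 H
  have hK : IsCompact {x : κ → H | IsBessel 𝕜 x} := by
    refine Metric.isCompact_of_isClosed_isBounded ?_ ?_
    · simp only [IsBessel, Set.ofPred_forall]
      exact isClosed_iInter fun t => isClosed_le (by fun_prop) continuous_const
    · refine (Metric.isBounded_iff_subset_closedBall 0).2 ⟨1, fun x hx => ?_⟩
      rw [mem_closedBall_zero_iff, pi_norm_le_iff_of_nonneg zero_le_one]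
      exact IsBessel.norm_le_one hx
  obtain ⟨x, hx, hmax⟩ := hK.exists_isMaxOn (f := fun x : κ → H => ∑ k, ‖u (x k)‖ ^ 2)
    ⟨0, fun t => by simp; positivity⟩ (by fun_prop)
  exact ⟨x, hx, fun y hy => hmax hy⟩

/-- One step of the selection of an orthonormal system: some unit vector `z` splits off so that the
loss in the maximal value of `∑ ‖u (x k)‖ ^ 2` is at most `2 ‖u z‖ ^ 2`. The vector `z` is a
normalised member of a maximising family. -/
lemma exists_norm_eq_one_le_sum {κ H X : Type*} [Fintype κ] [NormedAddCommGroup H]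
    [InnerProductSpace 𝕜 H] [NormedAddCommGroup X] [NormedSpace 𝕜 X] (u : H →L[𝕜] X) {x : κ → H}
    (hx : IsBessel 𝕜 x)
    (hmax : ∀ y : κ → H, IsBessel 𝕜 y → ∑ k, ‖u (y k)‖ ^ 2 ≤ ∑ k, ‖u (x k)‖ ^ 2)
    (h0 : x ≠ 0) :
    ∃ z : H, ‖z‖ = 1 ∧ ∑ k, ‖u (x k)‖ ^ 2 ≤
      ∑ k, ‖u (x k - inner 𝕜 z (x k) • z)‖ ^ 2 + 2 * ‖u z‖ ^ 2 := by
  choose b hb1 hb2 using fun k => exists_dual_vector'' 𝕜 (u (x k))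
  -- The linear functional that supports the convex function `∑ ‖u (y k)‖ ^ 2` at `x`.
  have hlin : ∀ y : κ → H, 2 * ∑ k, ‖u (x k)‖ * RCLike.re (b k (u (y k))) ≤
      ∑ k, ‖u (x k)‖ ^ 2 + ∑ k, ‖u (y k)‖ ^ 2 := by
    intro y
    rw [mul_sum, ← sum_add_distrib]
    refine sum_le_sum fun k _ => ?_
    have h1 : RCLike.re (b k (u (y k))) ≤ ‖u (y k)‖ :=
      (RCLike.re_le_norm _).trans (((b k).le_opNorm _).trans
        (mul_le_of_le_one_left (norm_nonneg _) (hb1 k)))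
    nlinarith [sq_nonneg (‖u (x k)‖ - ‖u (y k)‖), norm_nonneg (u (x k))]
  let s : H → ℝ := fun w => ∑ k, ‖u (x k)‖ * RCLike.re (inner 𝕜 w (x k) * b k (u w))
  have hs : ∀ (c : 𝕜) w, s (c • w) = ‖c‖ ^ 2 * s w := by
    intro c w
    simp only [s, mul_sum]
    refine sum_congr rfl fun k _ => ?_
    rw [map_smul, map_smul, inner_smul_left, smul_eq_mul]
    have : (starRingEnd 𝕜) c * inner 𝕜 w (x k) * (c * b k (u w)) =
        ((‖c‖ ^ 2 : ℝ) : 𝕜) * (inner 𝕜 w (x k) * b k (u w)) := by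
      push_cast
      rw [← RCLike.conj_mul]
      ring
    rw [this, RCLike.re_ofReal_mul]
    ring
  -- Compare `x = Z e` with the family `Z Zᴴ Z e`, which is a competitor for the maximum.
  have hsum : ∑ i, s (x i) ≤ ∑ i, ‖u (x i)‖ ^ 2 := by
    have h1 := hlin fun k => ∑ i, inner 𝕜 (x i) (x k) • x i
    have h2 := hmax _ hx.sum_inner_smul
    have h3 : ∑ k, ‖u (x k)‖ * RCLike.re (b k (u (∑ i, inner 𝕜 (x i) (x k) • x i))) =
        ∑ i, s (x i) := by
      simp only [s, map_sum, map_smul, smul_eq_mul, mul_sum]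
      exact sum_comm
    linarith
  obtain ⟨i, hi0, hi⟩ : ∃ i, x i ≠ 0 ∧ s (x i) ≤ ‖u (x i)‖ ^ 2 := by
    by_contra! hcon
    obtain ⟨i, hi⟩ := Function.ne_iff.1 h0
    refine hsum.not_gt (sum_lt_sum (fun j _ => ?_) ⟨i, mem_univ i, hcon i hi⟩)
    by_cases hj : x j = 0
    · simp [s, hj]
    · exact (hcon j hj).le
  have hxi : 0 < ‖x i‖ := norm_pos_iff.2 hi0
  set c : 𝕜 := ((‖x i‖⁻¹ : ℝ) : 𝕜) with hc
  have hcn : ‖c‖ = ‖x i‖⁻¹ := by rw [hc, RCLike.norm_ofReal, abs_of_pos (inv_pos.2 hxi)]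
  refine ⟨c • x i, by rw [norm_smul, hcn, inv_mul_cancel₀ hxi.ne'], ?_⟩
  have hsz : s (c • x i) ≤ ‖u (c • x i)‖ ^ 2 := by
    rw [hs, map_smul, norm_smul, mul_pow]
    gcongr
  set z := c • x i
  have h1 := hlin fun k => x k - inner 𝕜 z (x k) • z
  have h2 : ∑ k, ‖u (x k)‖ * RCLike.re (b k (u (x k - inner 𝕜 z (x k) • z))) =
      ∑ k, ‖u (x k)‖ ^ 2 - s z := by
    simp only [s, ← sum_sub_distrib]
    refine sum_congr rfl fun k _ => ?_
    rw [map_sub, map_sub, hb2, map_smul, map_smul, map_sub, RCLike.ofReal_re, smul_eq_mul]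
    ring
  linarith

/-- **Few vectors suffice for the 2-summing norm**: up to the factor `√2`, the 2-summing norm of an
operator on a Hilbert space of dimension `m` is attained on an orthonormal system of `m` vectors. -/
theorem exists_orthonormal_sum_le {κ X : Type*} [Fintype κ] [NormedAddCommGroup X]
    [NormedSpace 𝕜 X] (m : ℕ) :
    ∀ (H : Type*) [NormedAddCommGroup H] [InnerProductSpace 𝕜 H] [FiniteDimensional 𝕜 H],
      Module.finrank 𝕜 H = m → ∀ (u : H →L[𝕜] X) (y : κ → H), IsBessel 𝕜 y →
        ∃ z : Fin m → H, Orthonormal 𝕜 z ∧ ∑ k, ‖u (y k)‖ ^ 2 ≤ 2 * ∑ i, ‖u (z i)‖ ^ 2 := by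
  induction m with
  | zero =>
    intro H _ _ _ hm u y _
    have : Subsingleton H := Module.finrank_zero_iff.1 hm
    refine ⟨Fin.elim0, ⟨fun i => i.elim0, fun i => i.elim0⟩, ?_⟩
    simp [Subsingleton.elim (y _) 0]
  | succ m ih =>
    intro H _ _ _ hm u y hy
    obtain ⟨x, hx, hmax⟩ := exists_isBessel_max (κ := κ) u
    by_cases h0 : x = 0
    · have hle := hmax y hy
      rw [h0] at hle
      simp only [Pi.zero_apply, map_zero, norm_zero, ne_eq, OfNat.ofNat_ne_zero, not_false_eq_true,
        zero_pow, sum_const_zero] at hle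
      let b := (stdOrthonormalBasis 𝕜 H).reindex (finCongr hm)
      exact ⟨b, b.orthonormal, hle.trans (by positivity)⟩
    obtain ⟨z, hz, hle⟩ := exists_norm_eq_one_le_sum u hx hmax h0
    have hz0 : z ≠ 0 := norm_ne_zero_iff.1 (by rw [hz]; exact one_ne_zero)
    have : Fact (Module.finrank 𝕜 H = m + 1) := ⟨hm⟩
    set K : Submodule 𝕜 H := (𝕜 ∙ z)ᗮ with hK
    have hKm : Module.finrank 𝕜 K = m := Submodule.finrank_orthogonal_span_singleton hz0
    obtain ⟨w, hw, hle'⟩ := ih K hKm (u ∘L K.subtypeL) (fun k => K.orthogonalProjectionOnto (x k))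
      (hx.map K.orthogonalProjectionOnto_norm_le)
    refine ⟨Matrix.vecCons z fun i => (w i : H), ?_, ?_⟩
    · rw [orthonormal_vecCons_iff]
      refine ⟨hz, fun i => ?_, hw.comp_linearIsometry K.subtypeₗᵢ⟩
      exact Submodule.mem_orthogonal_singleton_iff_inner_right.1 (w i).2
    · have hproj : ∀ k, ((K.orthogonalProjectionOnto (x k) : K) : H) = x k - inner 𝕜 z (x k) • z := by
        intro k
        rw [← Submodule.starProjection_unit_singleton 𝕜 hz]
        exact Submodule.starProjection_orthogonal_val (x k)
      simp only [ContinuousLinearMap.comp_apply, Submodule.subtypeL_apply, hproj] at hle'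
      rw [Fin.sum_univ_succ]
      simp only [Matrix.cons_val_zero, Matrix.cons_val_succ]
      linarith [hmax y hy]

end Orthonormal

/-! ### Choice of the test families -/

section Core

variable {𝕜 : Type*} [RCLike 𝕜] {ι : Type*} [Fintype ι]

lemma IsBessel.comp_equiv {κ κ' E : Type*} [Fintype κ] [Fintype κ'] [NormedAddCommGroup E]
    [NormedSpace 𝕜 E] {x : κ → E} (hx : IsBessel 𝕜 x) (e : κ' ≃ κ) :
    IsBessel 𝕜 fun k => x (e k) := by
  intro t
  have h := hx fun k => t (e.symm k)
  rw [← e.sum_comp, ← e.sum_comp] at h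
  simpa using h

/-- Repeating the members of a Bessel family keeps it Bessel if the repeated copies are scaled so
that their squared weights have sum at most one. -/
lemma IsBessel.repeat_smul {κ κ' E : Type*} [Fintype κ] [Fintype κ'] [DecidableEq κ]
    [NormedAddCommGroup E] [NormedSpace 𝕜 E] {x : κ → E} (hx : IsBessel 𝕜 x) (f : κ' → κ)
    (c : κ' → ℝ) (hc : ∀ k, ∑ j with f j = k, c j ^ 2 ≤ 1) :
    IsBessel 𝕜 fun j => (c j : 𝕜) • x (f j) := by
  intro t
  have h1 : ∑ j, t j • (c j : 𝕜) • x (f j) =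
      ∑ k, (∑ j with f j = k, t j * (c j : 𝕜)) • x k := by
    rw [← sum_fiberwise univ f]
    refine sum_congr rfl fun k _ => ?_
    rw [sum_smul]
    refine sum_congr rfl fun j hj => ?_
    rw [(mem_filter.1 hj).2, mul_smul]
  rw [h1, ← sum_fiberwise univ f fun j => ‖t j‖ ^ 2]
  refine (hx _).trans (sum_le_sum fun k _ => ?_)
  have h2 : ‖∑ j with f j = k, t j * (c j : 𝕜)‖ ≤ ∑ j with f j = k, ‖t j‖ * |c j| :=
    (norm_sum_le _ _).trans_eq (sum_congr rfl fun j _ => by rw [norm_mul, RCLike.norm_ofReal])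
  calc _ ≤ (∑ j with f j = k, ‖t j‖ * |c j|) ^ 2 := by gcongr
    _ ≤ (∑ j with f j = k, ‖t j‖ ^ 2) * ∑ j with f j = k, |c j| ^ 2 := sum_mul_sq_le_sq_mul_sq _ _ _
    _ ≤ (∑ j with f j = k, ‖t j‖ ^ 2) * 1 := by
        gcongr
        simpa only [sq_abs] using hc k
    _ = _ := mul_one _

/-- Given `n` numbers `d k`, either the identity assignment or the assignment of a block of
`⌊n d_k² / ∑ d²⌋` indices to each `k` (with weights making every block have unit `ℓ_2` norm) has
`ℓ_1` sum of the order `√n` times the `ℓ_2` norm of `d`. -/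
lemma exists_assignment [DecidableEq ι] [Nonempty ι] {d : ι → ℝ} (hd : ∀ k, 0 ≤ d k) :
    ∃ (f : ι → ι) (c : ι → ℝ), (∀ j, 0 ≤ c j) ∧ (∀ k, ∑ j with f j = k, c j ^ 2 ≤ 1) ∧
      √(Fintype.card ι) * √(∑ k, d k ^ 2) ≤ 2 * ∑ j, c j * d (f j) := by
  set n : ℝ := (Fintype.card ι : ℝ) with hn
  have hnpos : 0 < n := by rw [hn]; exact_mod_cast Fintype.card_pos
  set D : ℝ := ∑ k, d k ^ 2 with hD
  have hD0 : 0 ≤ D := by positivity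
  rcases hD0.eq_or_lt with hDz | hDpos
  · refine ⟨id, 0, fun _ => le_rfl, fun k => by simp, by simp [← hDz]⟩
  let N : ι → ℕ := fun k => ⌊n * d k ^ 2 / D⌋₊
  have hNsum : ∑ k, N k ≤ Fintype.card ι := by
    have : ((∑ k, N k : ℕ) : ℝ) ≤ n := by
      push_cast
      calc ∑ k, (N k : ℝ) ≤ ∑ k, n * d k ^ 2 / D :=
            sum_le_sum fun k _ => Nat.floor_le (by have := hd k; positivity)
        _ = n := by rw [← sum_div, ← mul_sum, ← hD, mul_div_cancel_right₀ _ hDpos.ne']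
    rw [hn] at this
    exact_mod_cast this
  -- This is `√x ≤ √⌊x⌋ + 1` for `x = n d_k² / D`, multiplied by `d_k` and summed.
  have hkey : √n * √D ≤ ∑ k, √(N k) * d k + ∑ k, d k := by
    have h1 : ∀ k, √n * d k ^ 2 / √D ≤ √(N k) * d k + d k := by
      intro k
      have h2 : √(n * d k ^ 2 / D) ≤ √(N k) + 1 := by
        refine Real.sqrt_le_iff.2 ⟨by positivity, ?_⟩
        have h3 := (Nat.lt_floor_add_one (n * d k ^ 2 / D)).le
        have h4 : √(N k : ℝ) ^ 2 = N k := Real.sq_sqrt (Nat.cast_nonneg _)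
        have h5 := Real.sqrt_nonneg (N k : ℝ)
        change _ ≤ (N k : ℝ) + 1 at h3
        nlinarith
      have h3 : √(n * d k ^ 2 / D) = √n * d k / √D := by
        rw [Real.sqrt_div (by have := hd k; positivity), Real.sqrt_mul hnpos.le,
          Real.sqrt_sq (hd k)]
      calc √n * d k ^ 2 / √D = √(n * d k ^ 2 / D) * d k := by rw [h3]; ring
        _ ≤ (√(N k) + 1) * d k := by gcongr; exact hd k
        _ = _ := by ring
    have h4 := sum_le_sum fun k (_ : k ∈ univ) => h1 k
    rw [sum_add_distrib, ← sum_div, ← mul_sum, ← hD] at h4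
    refine le_of_eq_of_le ?_ h4
    rw [eq_div_iff (Real.sqrt_pos.2 hDpos).ne', mul_assoc, Real.mul_self_sqrt hD0]
  -- The larger of the two sums is at least half of the left side: it decides between the identity
  -- and the block assignment.
  by_cases hcase : ∑ k, √(N k) * d k ≤ ∑ k, d k
  · refine ⟨id, 1, fun _ => zero_le_one, fun k => ?_, ?_⟩
    · simp [filter_eq']
    · simp only [Pi.one_apply, one_mul, id]
      linarith
  · obtain ⟨e⟩ : Nonempty ((Σ k, Fin (N k)) ↪ ι) :=
      Function.Embedding.nonempty_of_card_le (by simpa using hNsum)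
    let f : ι → ι := Function.extend e Sigma.fst id
    let c : ι → ℝ := Function.extend e (fun a => 1 / √(N a.1)) 0
    have hc0 : ∀ j, 0 ≤ c j := by
      intro j
      by_cases hj : ∃ a, e a = j
      · obtain ⟨a, rfl⟩ := hj
        simp only [c, e.injective.extend_apply]
        positivity
      · simp [c, Function.extend_apply' _ _ _ hj]
    have hsum : ∀ F : ι → ℝ, (∀ j, (∀ a, e a ≠ j) → F j = 0) →
        ∑ j, F j = ∑ k, ∑ i : Fin (N k), F (e ⟨k, i⟩) := by
      intro F hF
      rw [← Fintype.sum_sigma fun a : (Σ k, Fin (N k)) => F (e a), ← sum_map univ e]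
      symm
      refine sum_subset (subset_univ _) fun j _ hj => hF j fun a ha => hj ?_
      simp [← ha]
    refine ⟨f, c, hc0, fun k => ?_, ?_⟩
    · rw [sum_filter, hsum _ fun j hj => by
        simp [c, Function.extend_apply' _ _ _ (not_exists.2 hj)]]
      simp only [f, c, e.injective.extend_apply]
      rw [sum_eq_single k (fun l _ hl => by simp [hl]) (by simp)]
      simp only [if_true, sum_const, card_univ, Fintype.card_fin, nsmul_eq_mul, div_pow, one_pow,
        Real.sq_sqrt (Nat.cast_nonneg (N k))]
      rw [mul_one_div]
      exact div_self_le_one _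
    · rw [hsum _ fun j hj => by simp [c, Function.extend_apply' _ _ _ (not_exists.2 hj)]]
      simp only [f, c, e.injective.extend_apply, sum_const, card_univ, Fintype.card_fin,
        nsmul_eq_mul]
      have : ∑ k, (N k : ℝ) * (1 / √(N k) * d k) = ∑ k, √(N k) * d k :=
        sum_congr rfl fun k _ => by
          rw [← mul_assoc, mul_one_div, Real.div_sqrt]
      rw [this]
      linarith

/-- Two families indexed by the same `n` indices can be permuted against each other so that the
inner product is at least `1 / n` times the product of the sums: average over cyclic shifts. -/
lemma exists_perm_sum_mul_sum_le [Nonempty ι] (a b : ι → ℝ) :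
    ∃ σ : Equiv.Perm ι, (∑ j, a j) * ∑ j, b j ≤ Fintype.card ι * ∑ j, a j * b (σ j) := by
  obtain ⟨m, hm⟩ := Nat.exists_eq_succ_of_ne_zero (Fintype.card_ne_zero (α := ι))
  let e : ι ≃ Fin (m + 1) := Fintype.equivFinOfCardEq hm
  let τ : Fin (m + 1) → Equiv.Perm ι := fun r => (e.trans (Equiv.addRight r)).trans e.symm
  have h1 : ∑ r, ∑ j, a j * b (τ r j) = (∑ j, a j) * ∑ j, b j := by
    rw [sum_comm, sum_mul]
    refine sum_congr rfl fun j _ => ?_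
    rw [← mul_sum]
    congr 1
    exact ((Equiv.addLeft (e j)).trans e.symm).sum_comp b
  obtain ⟨r, _, hr⟩ := exists_le_of_sum_le (s := (univ : Finset (Fin (m + 1)))) univ_nonempty
    (f := fun _ => ((∑ j, a j) * ∑ j, b j) / (m + 1))
    (g := fun r => ∑ j, a j * b (τ r j)) (by
      rw [h1]; simp; rw [mul_div_cancel₀]; positivity)
  refine ⟨τ r, ?_⟩
  rw [div_le_iff₀ (by positivity)] at hr
  rw [hm]
  push_cast
  linarith

variable {H : Type*} [NormedAddCommGroup H] [InnerProductSpace 𝕜 H]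

/-- For an operator `ℓ_∞ → H` of norm at most one, `h j` being the images of the unit vectors, there
is a Bessel family `g` such that the sum of the numbers `⟪g j, h j⟫ ≥ 0` is large whenever
`∑ ‖h j‖` is. It is obtained from `h` by dividing by the square roots of the Pietsch weights, with
`7` as a bound for `√48`. -/
lemma exists_isBessel_inner [Nonempty ι] {h : ι → H}
    (hh : ∀ (t : ι → 𝕜) (M : ℝ), 0 ≤ M → (∀ j, ‖t j‖ ≤ M) → ‖∑ j, t j • h j‖ ≤ M) :
    (∑ j, ‖h j‖) ≤ 7 * √(Fintype.card ι) ∧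
    ∃ (g : ι → H) (q : ι → ℝ), IsBessel 𝕜 g ∧ (∀ j, 0 ≤ q j) ∧
      (∀ j, inner 𝕜 (g j) (h j) = (q j : 𝕜)) ∧
      (∑ j, ‖h j‖) ^ 2 ≤ 7 * √(Fintype.card ι) * ∑ j, q j := by
  classical
  obtain ⟨p, hp0, hp1, hp⟩ := (isSumConst_of_norm_le hh).exists_weights (by norm_num)
  have hhp : ∀ j, ‖h j‖ ≤ 7 * √(p j) := by
    intro j
    have h1 := hp (Pi.single j 1)
    simp only [Pi.single_apply, ite_smul, one_smul, zero_smul, sum_ite_eq', mem_univ, if_true,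
      apply_ite (fun a : 𝕜 => ‖a‖ ^ 2), norm_one, norm_zero, mul_ite, one_pow, mul_one, ne_eq,
      OfNat.ofNat_ne_zero, not_false_eq_true, zero_pow, mul_zero] at h1
    refine abs_le_of_sq_le_sq' ?_ (by positivity) |>.2
    rw [mul_pow, Real.sq_sqrt (hp0 j)]
    linarith [hp0 j]
  have hl : ∑ j, √(p j) ≤ √(Fintype.card ι) := by
    refine Real.le_sqrt_of_sq_le ?_
    refine (sq_sum_le_card_mul_sum_sq).trans ?_
    simp only [Real.sq_sqrt (hp0 _), hp1, mul_one, card_univ, le_refl]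
  let a : ι → ℝ := fun j => (7 * √(p j))⁻¹
  have hz : ∀ j, p j = 0 → h j = 0 := by
    intro j hj
    have := hhp j
    rw [hj, Real.sqrt_zero, mul_zero] at this
    exact norm_le_zero_iff.1 this
  refine ⟨?_, fun j => (a j : 𝕜) • h j, fun j => a j * ‖h j‖ ^ 2, ?_, ?_, ?_, ?_⟩
  · calc _ ≤ ∑ j, 7 * √(p j) := sum_le_sum fun j _ => hhp j
      _ = 7 * ∑ j, √(p j) := by rw [mul_sum]
      _ ≤ _ := by gcongr
  · intro t
    have h1 := hp fun j => t j * (a j : 𝕜)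
    simp only [mul_smul] at h1
    refine h1.trans ?_
    rw [mul_sum]
    refine sum_le_sum fun j _ => ?_
    rw [norm_mul, mul_pow, RCLike.norm_ofReal, sq_abs]
    rcases (hp0 j).eq_or_lt with hj | hj
    · rw [← hj]; simp
    · have : p j * a j ^ 2 = 1 / 49 := by
        simp only [a, inv_pow, mul_pow, Real.sq_sqrt hj.le]
        field_simp
        norm_num
      nlinarith [sq_nonneg ‖t j‖]
  · intro j
    positivity
  · intro j
    rw [inner_smul_left, RCLike.conj_ofReal, inner_self_eq_norm_sq_to_K]
    push_cast
    ring
  · have hcs := sum_sq_le_sum_mul_sum_of_sq_le_mul univ (r := fun j => ‖h j‖)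
      (f := fun j => 7 * √(p j)) (g := fun j => a j * ‖h j‖ ^ 2)
      (fun j _ => by positivity) (fun j _ => by positivity) (fun j _ => by
        rcases (hp0 j).eq_or_lt with hj | hj
        · simp [hz j hj.symm, ← hj]
        · have : 7 * √(p j) * a j = 1 := mul_inv_cancel₀ (by positivity)
          rw [← mul_assoc, this, one_mul])
    refine hcs.trans ?_
    have : (0 : ℝ) ≤ ∑ j, a j * ‖h j‖ ^ 2 := by positivity
    rw [← mul_sum]
    gcongr

/-- For `h` the representing vectors of a norming functional, the value of the 2-summing inequality
for `u` at any Bessel family `y` is bounded by the sum of the `q j * ‖u (z j)‖` for suitable Bessel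
families `g` and `z`. For an ideal norm, that sum is in turn bounded by the ideal norm of `u`. -/
theorem exists_isBessel_sum_le {κ X : Type*} [Fintype κ] [NormedAddCommGroup X]
    [NormedSpace 𝕜 X] [Nonempty ι] [FiniteDimensional 𝕜 H]
    (hH : Module.finrank 𝕜 H = Fintype.card ι) {h : ι → H}
    (hh : ∀ (t : ι → 𝕜) (M : ℝ), 0 ≤ M → (∀ j, ‖t j‖ ≤ M) → ‖∑ j, t j • h j‖ ≤ M)
    (u : H →L[𝕜] X) {y : κ → H} (hy : IsBessel 𝕜 y) :
    ∃ (g z : ι → H) (q : ι → ℝ), IsBessel 𝕜 g ∧ IsBessel 𝕜 z ∧ (∀ j, 0 ≤ q j) ∧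
      (∀ j, inner 𝕜 (g j) (h j) = (q j : 𝕜)) ∧
      (∑ j, ‖h j‖) ^ 2 * √(∑ k, ‖u (y k)‖ ^ 2) ≤
        20 * Fintype.card ι * ∑ j, q j * ‖u (z j)‖ := by
  classical
  obtain ⟨-, g, q, hg, hq0, hq, hS⟩ := exists_isBessel_inner hh
  obtain ⟨w, hw, hwu⟩ := exists_orthonormal_sum_le _ H hH u y hy
  let e : ι ≃ Fin (Fintype.card ι) := Fintype.equivFin ι
  obtain ⟨f, c, hc0, hc1, hfc⟩ := exists_assignment (d := fun k => ‖u (w (e k))‖)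
    fun k => norm_nonneg _
  have hz := (hw.isBessel.comp_equiv e).repeat_smul f c hc1
  obtain ⟨σ, hσ⟩ := exists_perm_sum_mul_sum_le q fun j => ‖u ((c j : 𝕜) • w (e (f j)))‖
  refine ⟨g, fun j => (c (σ j) : 𝕜) • w (e (f (σ j))), q, hg, hz.comp_equiv σ, hq0, hq, ?_⟩
  set n : ℝ := (Fintype.card ι : ℝ)
  have hn : 0 ≤ n := Nat.cast_nonneg _
  set R := ∑ j, q j * ‖u ((c (σ j) : 𝕜) • w (e (f (σ j))))‖
  set Z := ∑ j, ‖u ((c j : 𝕜) • w (e (f j)))‖ with hZ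
  have hZ' : Z = ∑ j, c j * ‖u (w (e (f j)))‖ := by
    refine sum_congr rfl fun j _ => ?_
    rw [map_smul, norm_smul, RCLike.norm_ofReal, abs_of_nonneg (hc0 j)]
  rw [← hZ'] at hfc
  have hsq : √(∑ k, ‖u (y k)‖ ^ 2) ≤ √2 * √(∑ k, ‖u (w (e k))‖ ^ 2) := by
    rw [← Real.sqrt_mul (by norm_num)]
    refine Real.sqrt_le_sqrt (hwu.trans_eq ?_)
    rw [e.sum_comp fun i => ‖u (w i)‖ ^ 2]
  have hQ : 0 ≤ ∑ j, q j := sum_nonneg fun j _ => hq0 j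
  -- The constant is `7` from the Pietsch weights, `√2` from the orthonormal system and `2` from the
  -- assignment.
  have h2 : √2 * 14 ≤ (20 : ℝ) := by
    nlinarith [Real.sq_sqrt (show (0 : ℝ) ≤ 2 by norm_num), Real.sqrt_nonneg 2]
  have hR0 : 0 ≤ n * R := by
    have : 0 ≤ Z := by positivity
    exact (mul_nonneg hQ this).trans hσ
  calc (∑ j, ‖h j‖) ^ 2 * √(∑ k, ‖u (y k)‖ ^ 2)
      ≤ (7 * √n * ∑ j, q j) * (√2 * √(∑ k, ‖u (w (e k))‖ ^ 2)) := by gcongr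
    _ = 7 * √2 * (∑ j, q j) * (√n * √(∑ k, ‖u (w (e k))‖ ^ 2)) := by ring
    _ ≤ 7 * √2 * (∑ j, q j) * (2 * Z) := by gcongr
    _ = (√2 * 14) * ((∑ j, q j) * Z) := by ring
    _ ≤ (√2 * 14) * (n * R) := by gcongr
    _ ≤ 20 * (n * R) := by gcongr
    _ = 20 * n * R := by ring

end Core

/-! ### 2-summing constants and norming functionals -/

section TwoSumming

variable {𝕜 : Type} [RCLike 𝕜] {E Y : Type v} [NormedAddCommGroup E] [NormedSpace 𝕜 E]
  [NormedAddCommGroup Y] [NormedSpace 𝕜 Y]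

/-- The weak `ℓ_2` norm of a finite family, the supremum in the definition of a 2-summing
constant, bounds the norm of the operator from `ℓ_2` that the family defines. -/
lemma norm_sum_smul_sq_le {m : ℕ} (x : Fin m → E) (t : Fin m → 𝕜) :
    ‖∑ k, t k • x k‖ ^ 2 ≤
      (⨆ a : Metric.closedBall (0 : StrongDual 𝕜 E) 1, √(∑ k, ‖a.1 (x k)‖ ^ 2)) ^ 2 *
        ∑ k, ‖t k‖ ^ 2 := by
  obtain ⟨b, hb1, hb2⟩ := exists_dual_vector'' 𝕜 (∑ k, t k • x k)
  have hbdd : BddAbove (Set.range fun a : Metric.closedBall (0 : StrongDual 𝕜 E) 1 =>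
      √(∑ k, ‖a.1 (x k)‖ ^ 2)) := by
    refine ⟨√(∑ k, ‖x k‖ ^ 2), ?_⟩
    rintro _ ⟨a, rfl⟩
    refine Real.sqrt_le_sqrt (sum_le_sum fun k _ => ?_)
    gcongr
    exact (a.1.le_opNorm _).trans
      (mul_le_of_le_one_left (norm_nonneg _) (mem_closedBall_zero_iff.1 a.2))
  have h1 := le_ciSup hbdd ⟨b, mem_closedBall_zero_iff.2 hb1⟩
  have h2 : ‖∑ k, t k • x k‖ ≤ ∑ k, ‖b (x k)‖ * ‖t k‖ := by
    have : ‖b (∑ k, t k • x k)‖ ≤ ∑ k, ‖b (x k)‖ * ‖t k‖ := by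
      rw [map_sum]
      refine (norm_sum_le _ _).trans_eq (sum_congr rfl fun k _ => ?_)
      rw [map_smul, norm_smul, mul_comm]
    rwa [hb2, RCLike.norm_ofReal, abs_of_nonneg (norm_nonneg _)] at this
  calc _ ≤ (∑ k, ‖b (x k)‖ * ‖t k‖) ^ 2 := by gcongr
    _ ≤ (∑ k, ‖b (x k)‖ ^ 2) * ∑ k, ‖t k‖ ^ 2 := sum_mul_sq_le_sq_mul_sq _ _ _
    _ = √(∑ k, ‖b (x k)‖ ^ 2) ^ 2 * ∑ k, ‖t k‖ ^ 2 := by rw [Real.sq_sqrt (by positivity)]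
    _ ≤ _ := by gcongr

lemma isTwoSummingConst_of_isBessel (u : E →L[𝕜] Y) {C : ℝ}
    (hu : ∀ (m : ℕ) (y : Fin m → E), IsBessel 𝕜 y → √(∑ k, ‖u (y k)‖ ^ 2) ≤ C) :
    IsTwoSummingConst u C := by
  intro m x
  have hx := norm_sum_smul_sq_le (𝕜 := 𝕜) x
  have hs0 : 0 ≤ ⨆ a : Metric.closedBall (0 : StrongDual 𝕜 E) 1, √(∑ k, ‖a.1 (x k)‖ ^ 2) :=
    Real.iSup_nonneg fun _ => Real.sqrt_nonneg _
  set s := ⨆ a : Metric.closedBall (0 : StrongDual 𝕜 E) 1, √(∑ k, ‖a.1 (x k)‖ ^ 2)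
  rcases hs0.eq_or_lt with hs | hs
  · have hx0 : ∀ k, x k = 0 := by
      intro k
      have := hx (Pi.single k 1)
      simp only [← hs, Pi.single_apply, ite_smul, one_smul, zero_smul, sum_ite_eq', mem_univ,
        if_true] at this
      simpa using this
    simp [hx0, ← hs]
  · have hn : ‖((s⁻¹ : ℝ) : 𝕜)‖ = s⁻¹ := by
      rw [RCLike.norm_ofReal, abs_of_pos (inv_pos.2 hs)]
    have h1 := hu m (fun k => ((s⁻¹ : ℝ) : 𝕜) • x k) fun t => by
      simp only [smul_comm _ ((s⁻¹ : ℝ) : 𝕜), ← smul_sum]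
      rw [norm_smul, mul_pow, hn, inv_pow, inv_mul_le_iff₀ (by positivity)]
      exact hx t
    simp only [map_smul, norm_smul, mul_pow, hn] at h1
    rw [← mul_sum, Real.sqrt_mul (by positivity), Real.sqrt_sq (by positivity),
      inv_mul_le_iff₀ hs, mul_comm] at h1
    exact h1

lemma IsTwoSummingConst.mono {u : E →L[𝕜] Y} {C C' : ℝ} (h : IsTwoSummingConst u C)
    (hC : C ≤ C') : IsTwoSummingConst u C' := fun m x => (h m x).trans <|
  mul_le_mul_of_nonneg_right hC (Real.iSup_nonneg fun _ => Real.sqrt_nonneg _)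

lemma IsTwoSummingConst.isTwoSumming {u : E →L[𝕜] Y} {C : ℝ} (h : IsTwoSummingConst u C) :
    IsTwoSumming u :=
  ⟨max C 1, by positivity, h.mono (le_max_left _ _)⟩

lemma IsTwoSummingConst.piTwo_le {u : E →L[𝕜] Y} {C : ℝ} (h : IsTwoSummingConst u C)
    (hC : 0 ≤ C) : piTwo u ≤ C :=
  le_of_forall_pos_le_add fun ε hε =>
    csInf_le ⟨0, fun _ hc => hc.1.le⟩ ⟨by positivity, h.mono (by linarith)⟩

/-- Reduction of the estimate of `π₂` to bounds, one for each member `t` of a set of ratios, on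
Bessel families. -/
lemma sSup_pow_three_mul_piTwo_le (u : E →L[𝕜] Y) {R : Set ℝ} (hpos : ∃ t ∈ R, 0 < t)
    (h7 : ∀ t ∈ R, t ≤ 7) {K : ℝ} (hK : 0 ≤ K)
    (hR : ∀ t ∈ R, ∀ (m : ℕ) (y : Fin m → E), IsBessel 𝕜 y →
      t ^ 2 * √(∑ k, ‖u (y k)‖ ^ 2) ≤ K) :
    IsTwoSumming u ∧ sSup R ^ 3 * piTwo u ≤ 7 * K := by
  obtain ⟨t₀, ht₀, ht₀pos⟩ := hpos
  have hbdd : BddAbove R := ⟨7, h7⟩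
  set δ := sSup R with hδ
  have hδpos : 0 < δ := ht₀pos.trans_le (le_csSup hbdd ht₀)
  have hδ7 : δ ≤ 7 := csSup_le ⟨t₀, ht₀⟩ h7
  have h2 : ∀ (m : ℕ) (y : Fin m → E), IsBessel 𝕜 y →
      δ ^ 2 * √(∑ k, ‖u (y k)‖ ^ 2) ≤ K := by
    intro m y hy
    have hcl : IsClosed {t : ℝ | t ^ 2 * √(∑ k, ‖u (y k)‖ ^ 2) ≤ K} :=
      isClosed_le (by fun_prop) continuous_const
    exact hcl.closure_subset_iff.2 (fun t ht => hR t ht m y hy)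
      (csSup_mem_closure ⟨t₀, ht₀⟩ hbdd)
  have h3 : IsTwoSummingConst u (K / δ ^ 2) := isTwoSummingConst_of_isBessel u fun m y hy => by
    rw [le_div_iff₀ (by positivity), mul_comm]
    exact h2 m y hy
  refine ⟨h3.isTwoSumming, ?_⟩
  have h4 := h3.piTwo_le (by positivity)
  rw [le_div_iff₀ (by positivity)] at h4
  calc δ ^ 3 * piTwo u = δ * (piTwo u * δ ^ 2) := by ring
    _ ≤ δ * K := by gcongr
    _ ≤ 7 * K := by gcongr

end TwoSumming

/-- Hahn-Banach: a seminorm is attained at a given point by a functional that it dominates. -/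
lemma Seminorm.exists_dual_le {𝕜 V : Type*} [RCLike 𝕜] [AddCommGroup V] [Module 𝕜 V]
    (p : Seminorm 𝕜 V) (w : V) :
    ∃ φ : Module.Dual 𝕜 V, φ w = (p w : 𝕜) ∧ ∀ x, ‖φ x‖ ≤ p x := by
  by_cases hw : p w = 0
  · exact ⟨0, by simp [hw], fun x => by simp⟩
  have hw0 : w ≠ 0 := fun h => hw (by rw [h, map_zero])
  obtain ⟨φ, hφ1, hφ2⟩ := Module.Dual.exists_extension_of_le_seminorm (Submodule.span 𝕜 {w})
    ((p w : 𝕜) • (LinearEquiv.coord 𝕜 V w hw0)) (p := p) fun x => by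
      obtain ⟨x, hx⟩ := x
      obtain ⟨c, rfl⟩ := Submodule.mem_span_singleton.1 hx
      have : LinearEquiv.coord 𝕜 V w hw0 ⟨c • w, hx⟩ = c := by
        have := LinearEquiv.coord_apply_smul 𝕜 V w hw0 ⟨c • w, hx⟩
        exact smul_left_injective 𝕜 hw0 this
      simp only [LinearMap.smul_apply, smul_eq_mul, norm_mul, RCLike.norm_ofReal,
        abs_of_nonneg (apply_nonneg p w), map_smul_eq_mul]
      rw [LinearEquiv.coe_coe, this, mul_comm]
  refine ⟨φ, ?_, hφ2⟩
  have := hφ1 ⟨w, Submodule.mem_span_singleton_self w⟩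
  rw [this]
  simp [LinearEquiv.coord_self, RCLike.real_smul_eq_coe_mul]

/-! ### Ideal norms of operators from `ℓ_2^n` -/

section From

variable {𝕜 : Type} [RCLike 𝕜] {ι : Type v} [Fintype ι]

lemma PiLp.eq_sum_smul_single [DecidableEq ι] (p : ENNReal) (a : EllP 𝕜 p ι) :
    a = ∑ i, a i • PiLp.single p i (1 : 𝕜) := by
  ext k
  simp [Pi.single_apply]

/-- An operator on `ℓ_2^n` that factors through two Bessel families and a diagonal of signs is a
contraction; `b` is the Bessel family on the side of functionals. -/
lemma norm_sum_sgn_smul_le {H X : Type*} [NormedAddCommGroup H] [NormedSpace 𝕜 H]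
    [NormedAddCommGroup X] [NormedSpace 𝕜 X] [DecidableEq ι] {z : ι → X} (hz : IsBessel 𝕜 z)
    {b : ι → StrongDual 𝕜 H} (hb : ∀ y, ∑ i, ‖b i y‖ ^ 2 ≤ ‖y‖ ^ 2) (A : Finset ι) :
    ‖∑ i, sgn 𝕜 A i • (b i).smulRight (z i)‖ ≤ 1 := by
  refine ContinuousLinearMap.opNorm_le_bound _ zero_le_one fun y => ?_
  rw [one_mul]
  refine abs_le_of_sq_le_sq' ?_ (norm_nonneg _) |>.2
  have h1 := hz fun i => sgn 𝕜 A i * b i y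
  simp only [norm_mul, norm_sgn, one_mul, mul_smul] at h1
  simp only [_root_.sum_apply, _root_.smul_apply,
    ContinuousLinearMap.smulRight_apply]
  exact h1.trans (hb y)

lemma IdealNormFrom.norm_le (α : IdealNormFrom 𝕜 ι) {X : Type v} [NormedAddCommGroup X]
    [NormedSpace 𝕜 X] [CompleteSpace X] (u : EllP 𝕜 2 ι →L[𝕜] X) : ‖u‖ ≤ α.nrm X u := by
  simpa using α.opNorm_le X X (.id 𝕜 X) u (.id 𝕜 _)

/-- A norming functional for `α` at an operator `w` of norm one from `ℓ_2^n` to `ℓ_∞^n` is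
represented by `n` vectors in `ℓ_2^n`, which define an operator from `ℓ_∞^n` to `ℓ_2^n` of norm at
most one. -/
lemma IdealNormFrom.exists_norming (α : IdealNormFrom 𝕜 ι) {w : EllP 𝕜 2 ι →L[𝕜] EllP 𝕜 ⊤ ι}
    (hw : ‖w‖ ≤ 1) :
    ∃ h : ι → EllP 𝕜 2 ι,
      (∀ (t : ι → 𝕜) (M : ℝ), 0 ≤ M → (∀ j, ‖t j‖ ≤ M) → ‖∑ j, t j • h j‖ ≤ M) ∧
      α.nrm _ w ≤ ∑ j, ‖h j‖ ∧
      ∀ x : EllP 𝕜 2 ι →L[𝕜] EllP 𝕜 ⊤ ι, ‖∑ j, x (h j) j‖ ≤ α.nrm _ x := by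
  classical
  obtain ⟨φ, hφw, hφ⟩ := (α.nrm (EllP 𝕜 ⊤ ι)).exists_dual_le w
  let e : ι → EllP 𝕜 ⊤ ι := fun j => PiLp.single ⊤ j 1
  let h : ι → EllP 𝕜 2 ι := fun j =>
    WithLp.toLp 2 fun i => φ ((PiLp.proj 2 (fun _ : ι => 𝕜) i).smulRight (e j))
  have hrep : ∀ (b : StrongDual 𝕜 (EllP 𝕜 2 ι)) j, φ (b.smulRight (e j)) = b (h j) := by
    intro b j
    have e1 : b.smulRight (e j) = ∑ i, b (PiLp.single 2 i 1) •
        (PiLp.proj 2 (fun _ : ι => 𝕜) i).smulRight (e j) := by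
      ext a : 1
      conv_lhs => rw [PiLp.eq_sum_smul_single 2 a]
      simp only [ContinuousLinearMap.smulRight_apply, map_sum, map_smul,
        _root_.sum_apply, _root_.smul_apply, PiLp.proj_apply]
      exact sum_congr rfl fun i _ => smul_comm _ _ _
    rw [e1, map_sum]
    conv_rhs => rw [PiLp.eq_sum_smul_single 2 (h j)]
    simp only [map_sum, map_smul, smul_eq_mul, h]
    exact sum_congr rfl fun i _ => mul_comm _ _
  have hφx : ∀ x : EllP 𝕜 2 ι →L[𝕜] EllP 𝕜 ⊤ ι, φ x = ∑ j, x (h j) j := by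
    intro x
    have e1 : x = ∑ j, ((PiLp.proj ⊤ (fun _ : ι => 𝕜) j) ∘L x).smulRight (e j) := by
      ext a k
      simp [e, Pi.single_apply]
    conv_lhs => rw [e1]
    simp only [map_sum, hrep]
    rfl
  refine ⟨h, fun t M hM ht => ?_, ?_, fun x => hφx x ▸ hφ x⟩
  · obtain ⟨b, hb1, hb2⟩ := exists_dual_vector'' 𝕜 (∑ j, t j • h j)
    let y : EllP 𝕜 ⊤ ι := WithLp.toLp ⊤ t
    have hy : ‖y‖ ≤ M := by
      rw [PiLp.norm_eq_ciSup]
      exact Real.iSup_le ht hM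
    have h1 : φ (b.smulRight y) = b (∑ j, t j • h j) := by
      have : b.smulRight y = ∑ j, t j • b.smulRight (e j) := by
        ext a k
        simp [e, y, Pi.single_apply, mul_comm]
      rw [this]
      simp only [map_sum, map_smul, hrep]
    have h2 : α.nrm _ (b.smulRight y) = ‖b‖ * ‖y‖ := by
      have := α.rankOne (EllP 𝕜 ⊤ ι) ((InnerProductSpace.toDual 𝕜 (EllP 𝕜 2 ι)).symm b) y
      rw [LinearIsometryEquiv.norm_map] at this
      rw [← this]
      congr 2
      ext a
      simp
    have h3 := hφ (b.smulRight y)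
    rw [h1, hb2, RCLike.norm_ofReal, abs_of_nonneg (norm_nonneg _), h2] at h3
    calc _ ≤ ‖b‖ * ‖y‖ := h3
      _ ≤ 1 * M := by gcongr
      _ = M := one_mul M
  · have h1 : α.nrm _ w = ‖∑ j, w (h j) j‖ := by
      rw [← hφx, hφw, RCLike.norm_ofReal, abs_of_nonneg (apply_nonneg _ _)]
    rw [h1]
    refine (norm_sum_le _ _).trans (sum_le_sum fun j _ => ?_)
    exact (PiLp.norm_apply_le _ _).trans ((w.le_opNorm _).trans
      (mul_le_of_le_one_left (norm_nonneg _) hw))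

/-- The norming functional is tested on the operators `T u B`, where the coordinates of
`T : X → ℓ_∞^n` are signed norming functionals of the vectors `u (z j)` and `B = ∑ ± g i ⊗ z i`;
averaging over the signs leaves the diagonal. -/
lemma IdealNormFrom.sum_mul_norm_le (α : IdealNormFrom 𝕜 ι) {X : Type v} [NormedAddCommGroup X]
    [NormedSpace 𝕜 X] [CompleteSpace X] (u : EllP 𝕜 2 ι →L[𝕜] X) {h g z : ι → EllP 𝕜 2 ι}
    (hα : ∀ x : EllP 𝕜 2 ι →L[𝕜] EllP 𝕜 ⊤ ι, ‖∑ j, x (h j) j‖ ≤ α.nrm _ x)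
    (hg : IsBessel 𝕜 g) (hz : IsBessel 𝕜 z) {q : ι → ℝ}
    (hq : ∀ j, inner 𝕜 (g j) (h j) = (q j : 𝕜)) :
    ∑ j, q j * ‖u (z j)‖ ≤ α.nrm X u := by
  classical
  choose b hb1 hb2 using fun j => exists_dual_vector'' 𝕜 (u (z j))
  have key : ‖∑ j, inner 𝕜 (g j) (h j) * b j (u (z j))‖ ≤ α.nrm X u := by
    refine norm_sum_diag_le (m := fun j i => inner 𝕜 (g i) (h j) * b j (u (z i))) fun A => ?_
    let T : X →L[𝕜] EllP 𝕜 ⊤ ι :=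
      (PiLp.continuousLinearEquiv ⊤ 𝕜 (fun _ : ι => 𝕜)).symm.toContinuousLinearMap ∘L
        ContinuousLinearMap.pi fun j => sgn 𝕜 A j • b j
    have hTx : ∀ x j, T x j = sgn 𝕜 A j * b j x := fun x j => rfl
    have hT : ‖T‖ ≤ 1 := by
      refine ContinuousLinearMap.opNorm_le_bound _ zero_le_one fun x => ?_
      rw [PiLp.norm_eq_ciSup, one_mul]
      refine Real.iSup_le (fun j => ?_) (norm_nonneg _)
      rw [hTx, norm_mul, norm_sgn, one_mul]
      exact ((b j).le_opNorm _).trans (mul_le_of_le_one_left (norm_nonneg _) (hb1 j))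
    let B : EllP 𝕜 2 ι →L[𝕜] EllP 𝕜 2 ι :=
      ∑ i, sgn 𝕜 A i • (innerSL 𝕜 (g i)).smulRight (z i)
    have hB : ‖B‖ ≤ 1 := norm_sum_sgn_smul_le hz (fun y => hg.sum_norm_inner_sq_le y) A
    have h1 : ∑ j, (T ∘L u ∘L B) (h j) j =
        ∑ j, ∑ i, sgn 𝕜 A j * sgn 𝕜 A i * (inner 𝕜 (g i) (h j) * b j (u (z i))) := by
      refine sum_congr rfl fun j _ => ?_
      rw [ContinuousLinearMap.comp_apply, hTx, ContinuousLinearMap.comp_apply]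
      simp only [B, _root_.sum_apply, _root_.smul_apply,
        ContinuousLinearMap.smulRight_apply, innerSL_apply_apply, map_sum, map_smul, smul_eq_mul,
        mul_sum, mul_assoc]
    rw [← h1]
    have hu := apply_nonneg (α.nrm X) u
    calc _ ≤ _ := hα _
      _ ≤ ‖T‖ * α.nrm X u * ‖B‖ := α.ideal _ _ _ _ _
      _ ≤ 1 * α.nrm X u * 1 := by gcongr
      _ = _ := by ring
  have h2 : ∑ j, inner 𝕜 (g j) (h j) * b j (u (z j)) = ((∑ j, q j * ‖u (z j)‖ : ℝ) : 𝕜) := by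
    push_cast
    exact sum_congr rfl fun j _ => by rw [hq, hb2]
  rw [h2, RCLike.norm_ofReal] at key
  exact (le_abs_self _).trans key

lemma IdealNormFrom.ratios_bounds [Nonempty ι] (α : IdealNormFrom 𝕜 ι) :
    (∃ t ∈ α.ratios, 0 < t) ∧ ∀ t ∈ α.ratios, t ≤ 7 := by
  classical
  have hn : 0 < √(Fintype.card ι : ℝ) := by
    rw [Real.sqrt_pos]; exact_mod_cast Fintype.card_pos
  constructor
  · obtain ⟨i⟩ := ‹Nonempty ι›
    let w : EllP 𝕜 2 ι →L[𝕜] EllP 𝕜 ⊤ ι :=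
      (innerSL 𝕜 (PiLp.single 2 i (1 : 𝕜))).smulRight (PiLp.single ⊤ i (1 : 𝕜))
    have hw : ‖w‖ = 1 := by
      rw [ContinuousLinearMap.norm_smulRight_apply, innerSL_apply_norm, PiLp.norm_single,
        PiLp.norm_single, norm_one, mul_one]
    refine ⟨_, ⟨w, hw, rfl⟩, div_pos ?_ hn⟩
    exact zero_lt_one.trans_le (hw ▸ α.norm_le w)
  · rintro _ ⟨w, hw, rfl⟩
    obtain ⟨h, hh, hwh, -⟩ := α.exists_norming hw.le
    rw [div_le_iff₀ hn]
    exact hwh.trans (exists_isBessel_inner hh).1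

lemma IdealNormFrom.sq_mul_sqrt_le [Nonempty ι] (α : IdealNormFrom 𝕜 ι) {X : Type v}
    [NormedAddCommGroup X] [NormedSpace 𝕜 X] [CompleteSpace X] (u : EllP 𝕜 2 ι →L[𝕜] X)
    {t : ℝ} (ht : t ∈ α.ratios) {m : ℕ} {y : Fin m → EllP 𝕜 2 ι} (hy : IsBessel 𝕜 y) :
    t ^ 2 * √(∑ k, ‖u (y k)‖ ^ 2) ≤ 20 * α.nrm X u := by
  obtain ⟨w, hw, rfl⟩ := ht
  obtain ⟨h, hh, hwh, hα⟩ := α.exists_norming hw.le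
  obtain ⟨g, z, q, hg, hz, -, hq, hle⟩ :=
    exists_isBessel_sum_le (finrank_euclideanSpace (𝕜 := 𝕜) (ι := ι)) hh u hy
  have hn : (0 : ℝ) < Fintype.card ι := by exact_mod_cast Fintype.card_pos
  have h1 := α.sum_mul_norm_le u hα hg hz hq
  rw [div_pow, Real.sq_sqrt hn.le, div_mul_eq_mul_div, div_le_iff₀ hn]
  have h0 := apply_nonneg (α.nrm (EllP 𝕜 ⊤ ι)) w
  calc _ ≤ (∑ j, ‖h j‖) ^ 2 * √(∑ k, ‖u (y k)‖ ^ 2) := by gcongr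
    _ ≤ _ := hle
    _ ≤ 20 * Fintype.card ι * α.nrm X u := by gcongr
    _ = _ := by ring

end From

/-! ### Ideal norms of operators to `ℓ_2^n` -/

section To

variable {𝕜 : Type} [RCLike 𝕜] {ι : Type v} [Fintype ι]

lemma IdealNormTo.norm_le (β : IdealNormTo 𝕜 ι) {Y : Type v} [NormedAddCommGroup Y]
    [NormedSpace 𝕜 Y] [CompleteSpace Y] (v : Y →L[𝕜] EllP 𝕜 2 ι) : ‖v‖ ≤ β.nrm Y v := by
  simpa using β.opNorm_le Y Y (.id 𝕜 _) v (.id 𝕜 Y)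

/-- A norming functional for `β` at an operator `w` of norm one from `ℓ_1^n` to `ℓ_2^n` is
represented by `n` vectors in `ℓ_2^n`, which define an operator from `ℓ_∞^n` to `ℓ_2^n` of norm at
most one. -/
lemma IdealNormTo.exists_norming (β : IdealNormTo 𝕜 ι) [DecidableEq ι]
    {w : EllP 𝕜 1 ι →L[𝕜] EllP 𝕜 2 ι} (hw : ‖w‖ ≤ 1) :
    ∃ h : ι → EllP 𝕜 2 ι,
      (∀ (t : ι → 𝕜) (M : ℝ), 0 ≤ M → (∀ j, ‖t j‖ ≤ M) → ‖∑ j, t j • h j‖ ≤ M) ∧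
      β.nrm _ w ≤ ∑ j, ‖h j‖ ∧
      ∀ x : EllP 𝕜 1 ι →L[𝕜] EllP 𝕜 2 ι,
        ‖∑ j, inner 𝕜 (h j) (x (PiLp.single 1 j 1))‖ ≤ β.nrm _ x := by
  obtain ⟨ψ, hψw, hψ⟩ := (β.nrm (EllP 𝕜 1 ι)).exists_dual_le w
  let π : ι → StrongDual 𝕜 (EllP 𝕜 1 ι) := fun j => PiLp.proj 1 (fun _ : ι => 𝕜) j
  let c : ι → StrongDual 𝕜 (EllP 𝕜 2 ι) := fun j => LinearMap.toContinuousLinearMap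
    (ψ ∘ₗ (ContinuousLinearMap.smulRightL 𝕜 (EllP 𝕜 1 ι) (EllP 𝕜 2 ι) (π j)).toLinearMap)
  have hc : ∀ j y, c j y = ψ ((π j).smulRight y) := fun j y => rfl
  let h : ι → EllP 𝕜 2 ι := fun j => (InnerProductSpace.toDual 𝕜 (EllP 𝕜 2 ι)).symm (c j)
  have hrep : ∀ j y, inner 𝕜 (h j) y = ψ ((π j).smulRight y) := fun j y => by
    rw [← hc]
    exact InnerProductSpace.toDual_symm_apply
  have hψx : ∀ x : EllP 𝕜 1 ι →L[𝕜] EllP 𝕜 2 ι,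
      ψ x = ∑ j, inner 𝕜 (h j) (x (PiLp.single 1 j 1)) := by
    intro x
    have e1 : x = ∑ j, (π j).smulRight (x (PiLp.single 1 j 1)) := by
      ext a : 1
      conv_lhs => rw [PiLp.eq_sum_smul_single 1 a]
      simp only [map_sum, map_smul, _root_.sum_apply, ContinuousLinearMap.smulRight_apply, π,
        PiLp.proj_apply]
    conv_lhs => rw [e1]
    simp only [map_sum, hrep]
  refine ⟨h, fun t M hM ht => ?_, ?_, fun x => hψx x ▸ hψ x⟩
  · set y := ∑ j, t j • h j with hy
    let b : StrongDual 𝕜 (EllP 𝕜 1 ι) := ∑ j, star (t j) • π j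
    have hb : ‖b‖ ≤ M := by
      refine ContinuousLinearMap.opNorm_le_bound _ hM fun a => ?_
      simp only [b, _root_.sum_apply, _root_.smul_apply, π, PiLp.proj_apply]
      rw [PiLp.norm_eq_of_L1, mul_sum]
      refine (norm_sum_le _ _).trans (sum_le_sum fun j _ => ?_)
      rw [norm_smul, norm_star]
      gcongr
      exact ht j
    have h1 : ψ (b.smulRight y) = inner 𝕜 y y := by
      have : b.smulRight y = ∑ j, star (t j) • (π j).smulRight y := by
        ext a : 1
        simp only [b, ContinuousLinearMap.smulRight_apply, _root_.sum_apply, _root_.smul_apply,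
          sum_smul, smul_eq_mul, mul_smul]
      rw [this]
      conv_rhs => rw [hy, sum_inner]
      simp only [map_sum, map_smul, ← hrep, inner_smul_left, smul_eq_mul]
      rfl
    have h3 := hψ (b.smulRight y)
    rw [h1, β.rankOne, inner_self_eq_norm_sq_to_K, ← RCLike.ofReal_pow, RCLike.norm_ofReal,
      abs_of_nonneg (by positivity), sq] at h3
    rcases (norm_nonneg y).eq_or_lt with h0 | h0
    · rw [← h0]; exact hM
    · exact (le_of_mul_le_mul_right h3 h0).trans hb
  · have h1 : β.nrm _ w = ‖∑ j, inner 𝕜 (h j) (w (PiLp.single 1 j 1))‖ := by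
      rw [← hψx, hψw, RCLike.norm_ofReal, abs_of_nonneg (apply_nonneg _ _)]
    rw [h1]
    refine (norm_sum_le _ _).trans (sum_le_sum fun j _ => ?_)
    refine (norm_inner_le_norm _ _).trans (mul_le_of_le_one_right (norm_nonneg _) ?_)
    refine (w.le_opNorm _).trans ?_
    rw [PiLp.norm_single, norm_one, mul_one]
    exact hw

/-- The bilinear identification of `ℓ_2^n` with its dual (over `ℂ` it differs from the Riesz map,
which is conjugate linear). -/
noncomputable def euclideanDual (𝕜 : Type) [RCLike 𝕜] (ι : Type v) [Fintype ι] : EllP 𝕜 2 ι →ₗᵢ[𝕜] StrongDual 𝕜 (EllP 𝕜 2 ι) where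
  toFun y := innerSL 𝕜 (WithLp.toLp 2 fun i => star (y i))
  map_add' x y := by
    ext a
    simp [PiLp.inner_apply, mul_add, sum_add_distrib]
  map_smul' c y := by
    ext a
    simp only [innerSL_apply_apply, PiLp.inner_apply, _root_.smul_apply, smul_eq_mul, mul_sum,
      RingHom.id_apply, PiLp.smul_apply, RCLike.inner_apply, star_mul', RCLike.star_def, map_mul,
      RingHomCompTriple.comp_apply]
    exact sum_congr rfl fun i _ => by ring
  norm_map' y := by
    change ‖innerSL 𝕜 (WithLp.toLp 2 fun i => star (y i))‖ = ‖y‖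
    rw [innerSL_apply_norm, EuclideanSpace.norm_eq, EuclideanSpace.norm_eq]
    simp

lemma euclideanDual_surjective :
    Function.Surjective (euclideanDual 𝕜 ι) := by
  intro b
  let a := (InnerProductSpace.toDual 𝕜 (EllP 𝕜 2 ι)).symm b
  refine ⟨WithLp.toLp 2 fun i => star (a i), ?_⟩
  ext y
  change inner 𝕜 (WithLp.toLp 2 fun i => star (star (a i))) y = b y
  simp only [star_star]
  exact InnerProductSpace.toDual_symm_apply

lemma exists_norm_le_one_apply_eq {X : Type*} [NormedAddCommGroup X] [NormedSpace 𝕜 X]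
    (f : StrongDual 𝕜 X) : ∃ (x : X) (r : ℝ), ‖x‖ ≤ 1 ∧ ‖f‖ ≤ 2 * r ∧ f x = (r : 𝕜) := by
  rcases (norm_nonneg f).eq_or_lt with h | h
  · exact ⟨0, 0, by simp, by simp [← h], by simp⟩
  obtain ⟨x, hx, hfx⟩ := f.exists_lt_apply_of_lt_opNorm (half_lt_self h)
  have hpos : 0 < ‖f x‖ := by linarith
  refine ⟨(star (f x) / (‖f x‖ : 𝕜)) • x, ‖f x‖, ?_, by linarith, ?_⟩
  · rw [norm_smul, norm_div, norm_star, RCLike.norm_ofReal, abs_of_pos hpos, div_self hpos.ne',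
      one_mul]
    exact hx.le
  · have h0 : (‖f x‖ : 𝕜) ≠ 0 := by exact_mod_cast hpos.ne'
    rw [map_smul, smul_eq_mul, div_mul_eq_mul_div, RCLike.star_def, RCLike.conj_mul,
      div_eq_iff h0, sq]

/-- The norming functional is tested on the operators `B v T`, where `T` maps the unit vectors of
`ℓ_1^n` to signed near-norming points of the functionals `v* (z j)` and `B = ∑ ± z i ⊗ g i`;
averaging over the signs leaves the diagonal. -/
lemma IdealNormTo.sum_mul_norm_le (β : IdealNormTo 𝕜 ι) [DecidableEq ι] {X : Type v}
    [NormedAddCommGroup X] [NormedSpace 𝕜 X] [CompleteSpace X] (v : X →L[𝕜] EllP 𝕜 2 ι)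
    {h g z : ι → EllP 𝕜 2 ι}
    (hβ : ∀ x : EllP 𝕜 1 ι →L[𝕜] EllP 𝕜 2 ι,
      ‖∑ j, inner 𝕜 (h j) (x (PiLp.single 1 j 1))‖ ≤ β.nrm _ x)
    (hg : IsBessel 𝕜 g) (hz : IsBessel 𝕜 z) {q : ι → ℝ} (hq0 : ∀ j, 0 ≤ q j)
    (hq : ∀ j, inner 𝕜 (g j) (h j) = (q j : 𝕜)) :
    ∑ j, q j * ‖dualOp v (euclideanDual 𝕜 ι (z j))‖ ≤ 2 * β.nrm X v := by
  choose x r hx1 hr hxr using fun j => exists_norm_le_one_apply_eq (dualOp v (euclideanDual 𝕜 ι (z j)))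
  have hz' : IsBessel 𝕜 fun i => euclideanDual 𝕜 ι (z i) := by
    intro t
    have := hz t
    rw [← (euclideanDual 𝕜 ι).norm_map] at this
    simpa using this
  have hzy : ∀ y, ∑ i, ‖euclideanDual 𝕜 ι (z i) y‖ ^ 2 ≤ ‖y‖ ^ 2 := by
    intro y
    refine (hz'.sum_norm_apply_sq_le (ContinuousLinearMap.apply 𝕜 𝕜 y)).trans ?_
    gcongr
    refine ContinuousLinearMap.opNorm_le_bound _ (norm_nonneg _) fun f => ?_
    rw [mul_comm]
    exact f.le_opNorm y
  have key : ‖∑ j, inner 𝕜 (h j) (g j) * euclideanDual 𝕜 ι (z j) (v (x j))‖ ≤ β.nrm X v := by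
    refine norm_sum_diag_le
      (m := fun j i => inner 𝕜 (h j) (g i) * euclideanDual 𝕜 ι (z i) (v (x j))) fun A => ?_
    let T : EllP 𝕜 1 ι →L[𝕜] X :=
      ∑ j, sgn 𝕜 A j • (PiLp.proj 1 (fun _ : ι => 𝕜) j).smulRight (x j)
    have hTe : ∀ j, T (PiLp.single 1 j 1) = sgn 𝕜 A j • x j := by
      intro j
      simp only [T, _root_.sum_apply, _root_.smul_apply, ContinuousLinearMap.smulRight_apply,
        PiLp.proj_apply]
      rw [sum_eq_single j (fun k _ hk => by simp [hk]) (by simp)]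
      simp
    have hT : ‖T‖ ≤ 1 := by
      refine ContinuousLinearMap.opNorm_le_bound _ zero_le_one fun a => ?_
      rw [PiLp.norm_eq_of_L1, one_mul]
      simp only [T, _root_.sum_apply, _root_.smul_apply, ContinuousLinearMap.smulRight_apply,
        PiLp.proj_apply]
      refine (norm_sum_le _ _).trans (sum_le_sum fun j _ => ?_)
      rw [norm_smul, norm_sgn, one_mul, norm_smul]
      exact mul_le_of_le_one_right (norm_nonneg _) (hx1 j)
    let B : EllP 𝕜 2 ι →L[𝕜] EllP 𝕜 2 ι :=
      ∑ i, sgn 𝕜 A i • (euclideanDual 𝕜 ι (z i)).smulRight (g i)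
    have hB : ‖B‖ ≤ 1 := norm_sum_sgn_smul_le hg hzy A
    have h1 : ∑ j, inner 𝕜 (h j) ((B ∘L v ∘L T) (PiLp.single 1 j 1)) =
        ∑ j, ∑ i, sgn 𝕜 A j * sgn 𝕜 A i *
          (inner 𝕜 (h j) (g i) * euclideanDual 𝕜 ι (z i) (v (x j))) := by
      refine sum_congr rfl fun j _ => ?_
      rw [ContinuousLinearMap.comp_apply, ContinuousLinearMap.comp_apply, hTe, map_smul, map_smul,
        inner_smul_right]
      simp only [B, _root_.sum_apply, _root_.smul_apply, ContinuousLinearMap.smulRight_apply,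
        inner_sum, inner_smul_right, mul_sum]
      exact sum_congr rfl fun i _ => by ring
    rw [← h1]
    have hv := apply_nonneg (β.nrm X) v
    calc _ ≤ _ := hβ _
      _ ≤ ‖B‖ * β.nrm X v * ‖T‖ := β.ideal _ _ _ _ _
      _ ≤ 1 * β.nrm X v * 1 := by gcongr
      _ = _ := by ring
  have h2 : ∑ j, inner 𝕜 (h j) (g j) * euclideanDual 𝕜 ι (z j) (v (x j)) =
      ((∑ j, q j * r j : ℝ) : 𝕜) := by
    push_cast
    refine sum_congr rfl fun j _ => ?_
    rw [← inner_conj_symm, hq, RCLike.conj_ofReal]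
    exact congrArg _ (hxr j)
  rw [h2, RCLike.norm_ofReal] at key
  calc _ ≤ ∑ j, q j * (2 * r j) :=
        sum_le_sum fun j _ => mul_le_mul_of_nonneg_left (hr j) (hq0 j)
    _ = 2 * ∑ j, q j * r j := by
        rw [mul_sum]
        exact sum_congr rfl fun j _ => by ring
    _ ≤ 2 * β.nrm X v := by
        gcongr
        exact (le_abs_self _).trans key

lemma IdealNormTo.ratios_bounds [Nonempty ι] (β : IdealNormTo 𝕜 ι) :
    (∃ t ∈ β.ratios, 0 < t) ∧ ∀ t ∈ β.ratios, t ≤ 7 := by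
  classical
  have hn : 0 < √(Fintype.card ι : ℝ) := by
    rw [Real.sqrt_pos]; exact_mod_cast Fintype.card_pos
  constructor
  · obtain ⟨i⟩ := ‹Nonempty ι›
    let w : EllP 𝕜 1 ι →L[𝕜] EllP 𝕜 2 ι :=
      (PiLp.proj 1 (fun _ : ι => 𝕜) i).smulRight (PiLp.single 2 i (1 : 𝕜))
    have hp : ‖(PiLp.proj 1 (fun _ : ι => 𝕜) i : StrongDual 𝕜 (EllP 𝕜 1 ι))‖ = 1 := by
      refine le_antisymm (ContinuousLinearMap.opNorm_le_bound _ zero_le_one fun a => ?_) ?_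
      · rw [one_mul]
        exact PiLp.norm_apply_le a i
      · have := (PiLp.proj 1 (fun _ : ι => 𝕜) i : StrongDual 𝕜 (EllP 𝕜 1 ι)).le_opNorm
          (PiLp.single 1 i 1)
        rw [PiLp.norm_single, norm_one, mul_one, PiLp.proj_apply, PiLp.single_eq_same,
          norm_one] at this
        exact this
    have hw : ‖w‖ = 1 := by
      rw [ContinuousLinearMap.norm_smulRight_apply, PiLp.norm_single, norm_one, mul_one]
      exact hp
    refine ⟨_, ⟨w, hw, rfl⟩, div_pos ?_ hn⟩
    exact zero_lt_one.trans_le (hw ▸ β.norm_le w)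
  · rintro _ ⟨w, hw, rfl⟩
    obtain ⟨h, hh, hwh, -⟩ := β.exists_norming hw.le
    rw [div_le_iff₀ hn]
    exact hwh.trans (exists_isBessel_inner hh).1

lemma IdealNormTo.sq_mul_sqrt_le [Nonempty ι] (β : IdealNormTo 𝕜 ι) {X : Type v}
    [NormedAddCommGroup X] [NormedSpace 𝕜 X] [CompleteSpace X] (v : X →L[𝕜] EllP 𝕜 2 ι)
    {t : ℝ} (ht : t ∈ β.ratios) {m : ℕ} {y : Fin m → StrongDual 𝕜 (EllP 𝕜 2 ι)}
    (hy : IsBessel 𝕜 y) :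
    t ^ 2 * √(∑ k, ‖dualOp v (y k)‖ ^ 2) ≤ 40 * β.nrm X v := by
  classical
  obtain ⟨w, hw, rfl⟩ := ht
  obtain ⟨h, hh, hwh, hβ⟩ := β.exists_norming hw.le
  choose y' hy' using fun k => euclideanDual_surjective (y k)
  have hyB : IsBessel 𝕜 y' := by
    intro s
    have := hy s
    simp only [← hy', ← map_smul, ← map_sum, LinearIsometry.norm_map] at this
    exact this
  obtain ⟨g, z, q, hg, hz, hq0, hq, hle⟩ :=
    exists_isBessel_sum_le (finrank_euclideanSpace (𝕜 := 𝕜) (ι := ι)) hh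
      (dualOp v ∘L (euclideanDual 𝕜 ι).toContinuousLinearMap) hyB
  simp only [ContinuousLinearMap.comp_apply, LinearIsometry.coe_toContinuousLinearMap, hy'] at hle
  have hn : (0 : ℝ) < Fintype.card ι := by exact_mod_cast Fintype.card_pos
  have h1 := β.sum_mul_norm_le v hβ hg hz hq0 hq
  rw [div_pow, Real.sq_sqrt hn.le, div_mul_eq_mul_div, div_le_iff₀ hn]
  have h0 := apply_nonneg (β.nrm (EllP 𝕜 1 ι)) w
  calc _ ≤ (∑ j, ‖h j‖) ^ 2 * √(∑ k, ‖dualOp v (y k)‖ ^ 2) := by gcongr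
    _ ≤ _ := hle
    _ ≤ 20 * Fintype.card ι * (2 * β.nrm X v) := by gcongr
    _ = _ := by ring

end To

/-! ### The comparison with the 2-summing norm -/

theorem mainTheorem8 :
    ∃ c : ℝ, 0 < c ∧ ∀ (𝕜 : Type) [RCLike 𝕜] (ι : Type v) [Fintype ι] [Nonempty ι],
      (∀ α : IdealNormFrom 𝕜 ι,
        (α.ratios.Nonempty ∧ BddAbove α.ratios) ∧
        ∀ (X : Type v) [NormedAddCommGroup X] [NormedSpace 𝕜 X] [CompleteSpace X]
          (u : EllP 𝕜 2 ι →L[𝕜] X),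
          IsTwoSumming u ∧ sSup α.ratios ^ 3 * piTwo u ≤ c * α.nrm X u) ∧
      (∀ β : IdealNormTo 𝕜 ι,
        (β.ratios.Nonempty ∧ BddAbove β.ratios) ∧
        ∀ (X : Type v) [NormedAddCommGroup X] [NormedSpace 𝕜 X] [CompleteSpace X]
          (v : X →L[𝕜] EllP 𝕜 2 ι),
          IsTwoSumming (dualOp v) ∧ sSup β.ratios ^ 3 * piTwo (dualOp v) ≤ c * β.nrm X v) := by
  refine ⟨280, by norm_num, fun 𝕜 _ ι _ _ => ⟨fun α => ?_, fun β => ?_⟩⟩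
  · obtain ⟨⟨t, ht, ht0⟩, h7⟩ := α.ratios_bounds
    refine ⟨⟨⟨t, ht⟩, 7, h7⟩, fun X _ _ _ u => ?_⟩
    have h0 := apply_nonneg (α.nrm X) u
    obtain ⟨h1, h2⟩ := sSup_pow_three_mul_piTwo_le u ⟨t, ht, ht0⟩ h7
      (K := 20 * α.nrm X u) (by positivity) fun s hs m y hy => α.sq_mul_sqrt_le u hs hy
    exact ⟨h1, by linarith⟩
  · obtain ⟨⟨t, ht, ht0⟩, h7⟩ := β.ratios_bounds
    refine ⟨⟨⟨t, ht⟩, 7, h7⟩, fun X _ _ _ v => ?_⟩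
    have h0 := apply_nonneg (β.nrm X) v
    obtain ⟨h1, h2⟩ := sSup_pow_three_mul_piTwo_le (dualOp v) ⟨t, ht, ht0⟩ h7
      (K := 40 * β.nrm X v) (by positivity) fun s hs m y hy => β.sq_mul_sqrt_le v hs hy
    exact ⟨h1, by linarith⟩
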